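/- For $n\ge 1$ let $F_n(x)=\sum_{k=1}^n p_k(n)x^k$, where $p_k(n)$ is the number of partitions of $n$ with exactly $k$ parts. Let $\mathrm{Li}_2(x)=\sum_{m\ge1}x^m/m^2$ for $|x|\le 1$, let $\sqrt{\cdot}$ be the principal square root and $\ln$ the principal logarithm, and put $f_k(x)=\frac1k\,\mathrm{Re}\sqrt{\mathrm{Li}_2(x^k)}$. Let $U^+=\{x\in\mathbb C: |x|<1,\ \mathrm{Im}\,x>0\}$, and for $k\in\{1,2,3\}$ let $$\mathcal R(k)=\{x\in U^+ : f_k(x)>f_j(x)\ \text{for all}\ j\in\{1,2,3\},\ j\ne k\}.$$ For integers $0\le h<k$ with $\gcd(h,k)=1$ define $$w_{h,k}(x)=\frac1{2k}\ln(1-x^k)+\sum_{l\ge1,\ k\nmid l}\frac{x^l}{l}\,\frac1{e^{-2\pi i l h/k}-1},$$ $$I_k=I_k(n,x)=\frac1{2\sqrt\pi}\,\frac1{n^{3/4}}\left[\frac{\sqrt{\mathrm{Li}_2(x^k)}}{k}\right]^{1/2}\exp\!\left(2\sqrt n\,\frac{\sqrt{\mathrm{Li}_2(x^k)}}{k}\right),$$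 where $[\cdot]^{1/2}$ is again the principal square root. Then, as $n\to\infty$: (a) $F_n(x)=e^{w_{0,1}(x)}I_1+o(I_1)$, uniformly on every compact subset of $\mathcal R(1)$; (b) $F_n(x)=(-1)^n e^{w_{1,2}(x)}I_2+o(I_2)$, uniformly on every compact subset of $\mathcal R(2)$; (c) $F_n(x)=\left(e^{-2\pi i n/3}e^{w_{1,3}(x)}+e^{-4\pi i n/3}e^{w_{2,3}(x)}\right)I_3+o(I_3)$, uniformly on every compact subset of $\mathcal R(3)$. -/

import Mathlib

noncomputable section

namespace PartitionPolynomials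

/-- `p_k(n)`: the number of partitions of `n` with exactly `k` parts. -/
def numPartitions (k n : ℕ) : ℕ :=
  (Finset.univ.filter fun p : n.Partition => p.parts.card = k).card

/-- The partition polynomial `F_n(x) = ∑_{k=1}^n p_k(n) x^k`. -/
def F (n : ℕ) : Polynomial ℂ :=
  ∑ k ∈ Finset.Icc 1 n, Polynomial.C (numPartitions k n : ℂ) * Polynomial.X ^ k

/-- The dilogarithm `Li₂(x) = ∑_{m ≥ 1} x^m / m^2` (convergent for `‖x‖ ≤ 1`). -/
def Li2 (x : ℂ) : ℂ := ∑' m : ℕ, x ^ (m + 1) / ((m : ℂ) + 1) ^ 2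

/-- The principal square root on `ℂ`. -/
def csqrt (z : ℂ) : ℂ := z ^ (1 / 2 : ℂ)

/-- `L_k(x) = √(Li₂(x^k)) / k`. -/
def L (k : ℕ) (x : ℂ) : ℂ := csqrt (Li2 (x ^ k)) / k

/-- `f_k(x) = Re √(Li₂(x^k)) / k`. -/
def f (k : ℕ) (x : ℂ) : ℝ := (L k x).re

/-- The open upper half of the unit disk. -/
def upperHalfDisk : Set ℂ := {x | ‖x‖ < 1 ∧ 0 < x.im}

/-- The part of the upper half-disk on which `f_k` is strictly the largest
of `f_1, f_2, f_3` (for `k = 1, 2, 3`). -/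
def region (k : ℕ) : Set ℂ :=
  {x | x ∈ upperHalfDisk ∧ ∀ j ∈ Finset.Icc 1 3, j ≠ k → f j x < f k x}

/-- `w_{h,k}(x) = ln(1 - x^k) / (2k) + ∑_{l ≥ 1, k ∤ l} (x^l / l) / (e^{-2πi l h/k} - 1)`.
The index `l = 0` does not contribute, because `k ∣ 0`. -/
def w (h k : ℕ) (x : ℂ) : ℂ :=
  Complex.log (1 - x ^ k) / (2 * k) +
    ∑' l : ℕ, if k ∣ l then 0 else
      x ^ l / l * (1 / (Complex.exp (-2 * Real.pi * Complex.I * l * h / k) - 1))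

/-- `I_k = (1 / (2 √π)) n^{-3/4} [√(Li₂(x^k)) / k]^{1/2} exp(2 √n √(Li₂(x^k)) / k)`. -/
def mainTerm (k n : ℕ) (x : ℂ) : ℂ :=
  1 / (2 * (Real.sqrt Real.pi : ℂ)) * (((n : ℝ) ^ (-(3 / 4) : ℝ) : ℝ) : ℂ) *
    csqrt (L k x) * Complex.exp (2 * (Real.sqrt n : ℂ) * L k x)

/-- `A_n(x) = B_n(x) + o(E_n(x))` as `n → ∞`, uniformly for `x` in every compact subset of `S`. -/
def AsympOnCompacts (S : Set ℂ) (A B E : ℕ → ℂ → ℂ) : Prop :=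
  ∀ K : Set ℂ, IsCompact K → K ⊆ S → ∀ ε : ℝ, 0 < ε →
    ∃ N : ℕ, ∀ n ≥ N, ∀ x ∈ K, ‖A n x - B n x‖ ≤ ε * ‖E n x‖

end PartitionPolynomials

end

noncomputable section

namespace PartitionPolynomials

open Filter Topology

/-! ### The principal square root -/

/-! This is the circle method with a complex saddle point. The polynomial values `F n` at `x` are
the coefficients of `∏ (1 - x q^i)⁻¹ = exp (logGen x q)`, so Cauchy's formula on `|q| = e^{-σ}`
(`integral_exp_logGen`) turns the claim into an estimate of an integral.

Put `q = e^{2πih/k - τ}` with `τ = σ - iφ` and `h` coprime to `k`. Inserting `1/(e^z - 1) = 1/z -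
1/2 + O(z)` or `1/(ξ e^z - 1) = 1/(ξ - 1) + O(z)` in each term of `logGen` gives `logGen = L_k² / τ
+ w_{h,k} + O(τ)` in any sector `|φ| ≤ Mσ` (`exists_logGen_expansion`). The integrand is then about
`exp (w + L_k² / τ + nτ)`, whose saddle is `τ = L_k / √n`. Taking `σ = f_k / √n` puts the circle
through this saddle, and the Gaussian integral there produces `e^{w} I_k` with the phase
`e^{-2πinh/k}` (`tendsto_integral_window`).

The rest of the circle is smaller for the following reason. Near a point of order `j` the leading
term of `σ · Re logGen` is `Re (σ L_j² / τ)`, which is at most `f_j²` in every direction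
(`re_div_mul_sq_le`). So if `f_k` strictly dominates every other `f_j`, all angles outside the
windows lose a positive proportion of the exponent, uniformly by compactness of the arc
(`exists_minor_arc_bound`).

Membership in a region compares only `f_1, f_2, f_3`; the explicit dilogarithm estimates of
`f_lt_f_one_or_f_two` dispose of all `j ≥ 4`. All limits are taken along `atTop ×ˢ 𝓝 x`, hence are
locally uniform in `x`, and finite covers give uniformity on compact sets. -/

lemma csqrt_sq (z : ℂ) : csqrt z ^ 2 = z := by
  unfold csqrt
  rw [← Complex.cpow_nat_mul]
  norm_num

lemma csqrt_re_nonneg (z : ℂ) : 0 ≤ (csqrt z).re := by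
  unfold csqrt
  rcases eq_or_ne z 0 with rfl | hz
  · simp
  · rw [Complex.cpow_def_of_ne_zero hz, Complex.exp_re]
    refine mul_nonneg (Real.exp_pos _).le (Real.cos_nonneg_of_mem_Icc ?_)
    have h1 := Complex.neg_pi_lt_arg z
    have h2 := Complex.arg_le_pi z
    have : (Complex.log z * (1 / 2)).im = z.arg / 2 := by
      simp [Complex.mul_im, Complex.log_im]; ring
    rw [this]
    constructor <;> linarith

lemma re_csqrt_sq (z : ℂ) : (csqrt z).re ^ 2 = (‖z‖ + z.re) / 2 := by
  have h := csqrt_sq z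
  set a := csqrt z
  rw [← h, norm_pow, Complex.sq_norm, Complex.normSq_apply, pow_two a, Complex.mul_re]
  ring

/-- A half-plane tangent to the parabola `Re √z = b`. -/
lemma sq_lt_re_csqrt_sq {z : ℂ} {B : ℝ} (lam : ℝ) (h : B * (1 + lam ^ 2) < z.re + lam * z.im) :
    B < (csqrt z).re ^ 2 := by
  have h1 := csqrt_sq z
  set a := csqrt z
  rw [← h1, pow_two a, Complex.mul_re, Complex.mul_im] at h
  have : 0 < 1 + lam ^ 2 := by positivity
  nlinarith [sq_nonneg (a.im - lam * a.re)]

lemma f_nonneg (k : ℕ) (x : ℂ) : 0 ≤ f k x := by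
  unfold f L
  rw [Complex.div_natCast_re]
  exact div_nonneg (csqrt_re_nonneg _) (Nat.cast_nonneg _)

lemma f_sq (k : ℕ) (x : ℂ) : f k x ^ 2 = (csqrt (Li2 (x ^ k))).re ^ 2 / (k : ℝ) ^ 2 := by
  unfold f L
  rw [Complex.div_natCast_re, div_pow]

/-! ### The dilogarithm -/

lemma summable_one_div_succ_sq : Summable fun m : ℕ => 1 / ((m : ℝ) + 1) ^ 2 := by
  have := (summable_nat_add_iff 1).2 hasSum_zeta_two.summable
  simpa using this

lemma tsum_one_div_succ_sq : ∑' m : ℕ, 1 / ((m : ℝ) + 1) ^ 2 = Real.pi ^ 2 / 6 := by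
  have h := hasSum_zeta_two.tsum_eq
  rw [hasSum_zeta_two.summable.tsum_eq_zero_add] at h
  simpa using h

lemma norm_Li2_term (x : ℂ) (m : ℕ) :
    ‖x ^ (m + 1) / ((m : ℂ) + 1) ^ 2‖ = ‖x‖ ^ (m + 1) * (1 / ((m : ℝ) + 1) ^ 2) := by
  have : ‖(m : ℂ) + 1‖ = (m : ℝ) + 1 := by
    rw [← Nat.cast_add_one, Complex.norm_natCast]; push_cast; rfl
  rw [norm_div, norm_pow, norm_pow, this]
  ring

lemma summable_norm_Li2 {x : ℂ} (hx : ‖x‖ ≤ 1) :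
    Summable fun m : ℕ => ‖x ^ (m + 1) / ((m : ℂ) + 1) ^ 2‖ := by
  refine Summable.of_nonneg_of_le (fun _ => norm_nonneg _) (fun m => ?_)
    summable_one_div_succ_sq
  rw [norm_Li2_term]
  exact mul_le_of_le_one_left (by positivity) (pow_le_one₀ (norm_nonneg _) hx)

lemma norm_Li2_le {x : ℂ} (hx : ‖x‖ ≤ 1) : ‖Li2 x‖ ≤ ‖x‖ * (Real.pi ^ 2 / 6) := by
  unfold Li2
  refine (norm_tsum_le_tsum_norm (summable_norm_Li2 hx)).trans ?_
  rw [← tsum_one_div_succ_sq, ← tsum_mul_left]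
  refine Summable.tsum_le_tsum (fun m => ?_) (summable_norm_Li2 hx)
    (summable_one_div_succ_sq.mul_left _)
  rw [norm_Li2_term]
  gcongr
  exact pow_le_of_le_one (norm_nonneg _) hx (by simp)

lemma Li2_conj (x : ℂ) : Li2 ((starRingEnd ℂ) x) = (starRingEnd ℂ) (Li2 x) := by
  unfold Li2
  rw [Complex.conj_tsum]
  simp

lemma hasDerivAt_Li2 {x : ℂ} (hx : ‖x‖ < 1) :
    HasDerivAt Li2 (∑' m : ℕ, x ^ m / ((m : ℂ) + 1)) x := by
  obtain ⟨ρ, h1, h2⟩ := exists_between hx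
  have hρ : 0 ≤ ρ := (norm_nonneg x).trans h1.le
  have key : ∀ (m : ℕ) (y : ℂ), HasDerivAt (fun z : ℂ => z ^ (m + 1) / ((m : ℂ) + 1) ^ 2)
      (y ^ m / ((m : ℂ) + 1)) y := by
    intro m y
    have h : ((m : ℂ) + 1) ≠ 0 := Nat.cast_add_one_ne_zero m
    refine ((hasDerivAt_pow (m + 1) y).div_const (((m : ℂ) + 1) ^ 2)).congr_deriv ?_
    push_cast
    field_simp
  have bound : ∀ (m : ℕ) (y : ℂ), y ∈ Metric.ball (0 : ℂ) ρ → ‖y ^ m / ((m : ℂ) + 1)‖ ≤ ρ ^ m := by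
    intro m y hy
    have h : 1 ≤ ‖(m : ℂ) + 1‖ := by
      rw [← Nat.cast_add_one, Complex.norm_natCast]; simp
    rw [norm_div, norm_pow]
    refine (div_le_self (by positivity) h).trans ?_
    gcongr
    exact (mem_ball_zero_iff.1 hy).le
  have hmem : x ∈ Metric.ball (0 : ℂ) ρ := mem_ball_zero_iff.2 h1
  exact hasDerivAt_tsum_of_isPreconnected (u := fun m => ρ ^ m)
    (g := fun (m : ℕ) (z : ℂ) => z ^ (m + 1) / ((m : ℂ) + 1) ^ 2)
    (g' := fun (m : ℕ) (z : ℂ) => z ^ m / ((m : ℂ) + 1))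
    (summable_geometric_of_lt_one hρ h2) Metric.isOpen_ball
    (convex_ball (0 : ℂ) ρ).isPreconnected (fun m y _ => key m y) bound
    hmem (summable_norm_Li2 hx.le).of_norm hmem

lemma mul_tsum_pow_div_succ {x : ℂ} (hx : ‖x‖ < 1) :
    x * ∑' m : ℕ, x ^ m / ((m : ℂ) + 1) = -Complex.log (1 - x) := by
  have h := Complex.hasSum_taylorSeries_neg_log hx
  rw [← h.tsum_eq, h.summable.tsum_eq_zero_add, ← tsum_mul_left]
  simp only [pow_zero, Nat.cast_zero, div_zero, zero_add, Nat.cast_add, Nat.cast_one]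
  congr 1 with m
  ring

/-- Lower bounds for linear functionals of `Li₂` from the integrand of
`Li₂ x = -∫₀¹ log (1 - t x) dt / t`. -/
lemma le_re_mul_Li2 {x : ℂ} (hx : ‖x‖ < 1) (c : ℂ) (a b : ℝ)
    (h : ∀ t ∈ Set.Ioo (0 : ℝ) 1, t * (a + b * t) ≤ (c * -Complex.log (1 - t * x)).re) :
    a + b / 2 ≤ (c * Li2 x).re := by
  have hn : ∀ t ∈ Set.Icc (0 : ℝ) 1, ‖(t : ℂ) * x‖ < 1 := by
    intro t ht
    rw [norm_mul, Complex.norm_real, Real.norm_of_nonneg ht.1]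
    nlinarith [norm_nonneg x, ht.1, ht.2]
  have hd : ∀ t ∈ Set.Icc (0 : ℝ) 1,
      HasDerivAt (fun s : ℝ => (c * Li2 (s * x)).re - (a * s + b * s ^ 2 / 2))
        ((c * ((∑' m : ℕ, (t * x) ^ m / ((m : ℂ) + 1)) * x)).re - (a + b * t)) t := by
    intro t ht
    have h1 : HasDerivAt (fun s : ℝ => c * Li2 (s * x))
        (c * ((∑' m : ℕ, (t * x) ^ m / ((m : ℂ) + 1)) * x)) t := by
      have h2 : HasDerivAt (fun s : ℂ => s * x) x (t : ℂ) := by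
        simpa using (hasDerivAt_id (t : ℂ)).mul_const x
      exact ((HasDerivAt.comp (t : ℂ) (hasDerivAt_Li2 (hn t ht)) h2).comp_ofReal).const_mul c
    have h3 : HasDerivAt (fun s : ℝ => (c * Li2 (s * x)).re)
        (c * ((∑' m : ℕ, (t * x) ^ m / ((m : ℂ) + 1)) * x)).re t :=
      (Complex.reCLM.hasFDerivAt.comp_hasDerivAt t h1)
    have h4 : HasDerivAt (fun s : ℝ => a * s + b * s ^ 2 / 2) (a + b * t) t := by
      have := ((hasDerivAt_id t).const_mul a).add (((hasDerivAt_pow 2 t).const_mul b).div_const 2)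
      refine this.congr_deriv ?_
      norm_num
      ring
    exact h3.sub h4
  -- Monotonicity of the difference on `[0, 1]` takes the place of integrating the hypothesis
  -- divided by `t`.
  have hm : MonotoneOn (fun s : ℝ => (c * Li2 (s * x)).re - (a * s + b * s ^ 2 / 2))
      (Set.Icc 0 1) := by
    refine monotoneOn_of_hasDerivWithinAt_nonneg (convex_Icc 0 1)
      (fun t ht => (hd t ht).continuousAt.continuousWithinAt)
      (fun t ht => (hd t (interior_subset ht)).hasDerivWithinAt) (fun t ht => ?_)
    rw [interior_Icc] at ht
    have h1 := h t ht
    have h2 := mul_tsum_pow_div_succ (hn t (Set.Ioo_subset_Icc_self ht))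
    rw [← h2] at h1
    have h3 : (c * (t * x * ∑' m : ℕ, (t * x) ^ m / ((m : ℂ) + 1))).re
        = t * (c * ((∑' m : ℕ, (t * x) ^ m / ((m : ℂ) + 1)) * x)).re := by
      rw [← Complex.re_ofReal_mul]; congr 1; ring
    rw [h3] at h1
    have := le_of_mul_le_mul_left h1 ht.1
    linarith
  have := hm (Set.left_mem_Icc.2 zero_le_one) (Set.right_mem_Icc.2 zero_le_one) zero_le_one
  have h0 : Li2 0 = 0 := by simp [Li2]
  simp only [Complex.ofReal_zero, zero_mul, h0, mul_zero, Complex.zero_re, Complex.ofReal_one,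
    one_mul, mul_one, one_pow] at this
  linarith

lemma one_sub_ne_zero {z : ℂ} (hz : ‖z‖ < 1) : 1 - z ≠ 0 := by
  intro h
  rw [sub_eq_zero] at h
  simp [← h] at hz

lemma log_norm_one_sub (z : ℂ) :
    (Complex.log (1 - z)).re = Real.log (1 - 2 * z.re + ‖z‖ ^ 2) / 2 := by
  have h : 1 - 2 * z.re + ‖z‖ ^ 2 = ‖1 - z‖ ^ 2 := by
    rw [Complex.sq_norm, Complex.sq_norm, Complex.normSq_apply, Complex.normSq_apply]
    simp; ring
  rw [Complex.log_re, h, Real.log_pow]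
  push_cast; ring

lemma one_sub_two_re_pos {z : ℂ} (hz : ‖z‖ < 1) : 0 < 1 - 2 * z.re + ‖z‖ ^ 2 := by
  have h : 1 - 2 * z.re + ‖z‖ ^ 2 = ‖1 - z‖ ^ 2 := by
    rw [Complex.sq_norm, Complex.sq_norm, Complex.normSq_apply, Complex.normSq_apply]
    simp; ring
  rw [h]
  have := norm_pos_iff.2 (one_sub_ne_zero hz)
  positivity

lemma norm_ofReal_mul_lt {x : ℂ} (hx : ‖x‖ < 1) {t : ℝ} (ht : t ∈ Set.Ioo (0 : ℝ) 1) :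
    ‖(t : ℂ) * x‖ = t * ‖x‖ ∧ ‖(t : ℂ) * x‖ < 1 := by
  have : ‖(t : ℂ) * x‖ = t * ‖x‖ := by
    rw [norm_mul, Complex.norm_real, Real.norm_of_nonneg ht.1.le]
  refine ⟨this, ?_⟩
  rw [this]
  nlinarith [norm_nonneg x, ht.1, ht.2]

/-- Comes from `log s ≤ s - 1` applied to `s = |1 - tx|²`. -/
lemma re_sub_le_re_Li2 {x : ℂ} (hx : ‖x‖ < 1) : x.re - ‖x‖ ^ 2 / 4 ≤ (Li2 x).re := by
  have := le_re_mul_Li2 hx 1 x.re (-(‖x‖ ^ 2) / 2) (fun t ht => ?_)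
  · rw [one_mul] at this; linarith
  · obtain ⟨h1, h2⟩ := norm_ofReal_mul_lt hx ht
    rw [one_mul, Complex.neg_re, log_norm_one_sub]
    have h3 := Real.log_le_sub_one_of_pos (one_sub_two_re_pos h2)
    rw [h1, Complex.re_ofReal_mul] at *
    nlinarith

/-- With `s = t‖x‖`, `|1 - tx|² ≤ 1 + 2κs + s² ≤ 1 + 2κs + (2κs)²/2 ≤ e^{2κs}`; the middle step is
where `1 ≤ 2κ²` enters. -/
lemma neg_mul_norm_le_re_Li2 {x : ℂ} (hx : ‖x‖ < 1) {κ : ℝ} (hκ : 0 ≤ κ) (hκ2 : 1 ≤ 2 * κ ^ 2)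
    (h : -(κ * ‖x‖) ≤ x.re) : -(κ * ‖x‖) ≤ (Li2 x).re := by
  have := le_re_mul_Li2 hx 1 (-(κ * ‖x‖)) 0 (fun t ht => ?_)
  · rw [one_mul] at this; linarith
  · obtain ⟨h1, h2⟩ := norm_ofReal_mul_lt hx ht
    rw [one_mul, Complex.neg_re, log_norm_one_sub]
    have h0 : 0 ≤ t * ‖x‖ := mul_nonneg ht.1.le (norm_nonneg _)
    have h3 : Real.log (1 - 2 * ((t : ℂ) * x).re + ‖(t : ℂ) * x‖ ^ 2) ≤ 2 * κ * (t * ‖x‖) := by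
      rw [Real.log_le_iff_le_exp (one_sub_two_re_pos h2)]
      refine le_trans ?_ (Real.quadratic_le_exp_of_nonneg (by positivity))
      rw [h1, Complex.re_ofReal_mul]
      nlinarith [mul_le_mul_of_nonneg_left h ht.1.le, mul_le_mul_of_nonneg_left hκ2 (sq_nonneg (t * ‖x‖))]
    linarith

lemma re_Li2_nonpos {x : ℂ} (hx : ‖x‖ < 1) (h : x.re ≤ 0) : (Li2 x).re ≤ 0 := by
  have := le_re_mul_Li2 hx (-1) 0 0 (fun t ht => ?_)
  · simp at this; linarith
  · obtain ⟨h1, h2⟩ := norm_ofReal_mul_lt hx ht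
    rw [neg_one_mul, neg_neg, log_norm_one_sub]
    have : 0 ≤ Real.log (1 - 2 * ((t : ℂ) * x).re + ‖(t : ℂ) * x‖ ^ 2) := by
      refine Real.log_nonneg ?_
      rw [Complex.re_ofReal_mul]
      nlinarith [mul_nonneg ht.1.le (neg_nonneg.2 h), sq_nonneg ‖(t : ℂ) * x‖]
    linarith

/-- The integrand is `-arg (1 - tx) / t ≥ x.im / |1 - tx|`, by `sin α ≤ α`. Convexity of the norm
gives `|1 - tx| ≤ 1 + κt` with `κ = |1 - x| - 1`, and the convex function `1 / (1 + κt)` lies above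
its tangent at `t = 1/2`, whose integral is the midpoint value `2 / (1 + |1 - x|)`. -/
lemma le_im_Li2 {x : ℂ} (hx : ‖x‖ < 1) (h : 0 ≤ x.im) :
    2 * x.im / (1 + ‖1 - x‖) ≤ (Li2 x).im := by
  set D := ‖1 - x‖ with hD
  have hD0 : 0 ≤ D := norm_nonneg _
  set κ := D - 1
  have hq : 0 < 1 + κ / 2 := by simp only [κ]; linarith
  have := le_re_mul_Li2 hx (-Complex.I) (x.im * (1 / (1 + κ / 2) + κ / 2 / (1 + κ / 2) ^ 2))
    (-(x.im * (κ / (1 + κ / 2) ^ 2))) (fun t ht => ?_)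
  · have e : (-Complex.I * Li2 x).re = (Li2 x).im := by simp
    rw [e] at this
    refine le_trans (le_of_eq ?_) this
    have e1 : 1 + D = 2 * (1 + κ / 2) := by simp only [κ]; ring
    have e2 : κ = 2 * (1 + κ / 2) - 2 := by ring
    rw [e1]
    generalize 1 + κ / 2 = q at hq e2 ⊢
    rw [e2]
    field_simp
    ring
  · obtain ⟨h1, h2⟩ := norm_ofReal_mul_lt hx ht
    have e : (-Complex.I * -Complex.log (1 - t * x)).re = -(1 - (t : ℂ) * x).arg := by
      simp [Complex.log_im]
    rw [e]
    have him : (1 - (t : ℂ) * x).im = -(t * x.im) := by simp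
    have harg : (1 - (t : ℂ) * x).arg ≤ 0 := by
      rcases h.eq_or_lt with h0 | h0
      · have : (1 - (t : ℂ) * x) = ((1 - t * x.re : ℝ) : ℂ) := by
          apply Complex.ext <;> simp [← h0]
        rw [this, Complex.arg_ofReal_of_nonneg]
        have := (Complex.re_le_norm ((t : ℂ) * x)).trans h2.le
        rw [Complex.re_ofReal_mul] at this
        linarith
      · exact (Complex.arg_neg_iff.2 (by rw [him]; nlinarith [ht.1])).le
    have h3 : Real.sin (-(1 - (t : ℂ) * x).arg) ≤ -(1 - (t : ℂ) * x).arg :=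
      Real.sin_le (by linarith)
    rw [Real.sin_neg, Complex.sin_arg, him] at h3
    refine le_trans ?_ h3
    have hpos : 0 < ‖1 - (t : ℂ) * x‖ := norm_pos_iff.2 (one_sub_ne_zero h2)
    have hle : ‖1 - (t : ℂ) * x‖ ≤ 1 + κ * t := by
      have : 1 - (t : ℂ) * x = ((1 - t : ℝ) : ℂ) + (t : ℂ) * (1 - x) := by push_cast; ring
      rw [this]
      refine (norm_add_le _ _).trans ?_
      rw [norm_mul, Complex.norm_real, Complex.norm_real, Real.norm_of_nonneg ht.1.le,
        Real.norm_of_nonneg (by linarith [ht.2]), ← hD]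
      simp only [κ]; linarith
    have hkt : 0 < 1 + κ * t := hpos.trans_le hle
    rw [← neg_div, neg_neg, mul_div_assoc]
    have h5 : x.im * (1 / (1 + κ * t)) ≤ x.im / ‖1 - (t : ℂ) * x‖ := by
      rw [mul_one_div]; gcongr
    refine mul_le_mul_of_nonneg_left (le_trans ?_ h5) ht.1.le
    have h6 : 1 / (1 + κ / 2) + κ / 2 / (1 + κ / 2) ^ 2 - κ / (1 + κ / 2) ^ 2 * t
        ≤ 1 / (1 + κ * t) := by
      rw [← sub_nonneg]
      have : 1 / (1 + κ * t) - (1 / (1 + κ / 2) + κ / 2 / (1 + κ / 2) ^ 2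
          - κ / (1 + κ / 2) ^ 2 * t)
          = (κ * t - κ / 2) ^ 2 / ((1 + κ * t) * (1 + κ / 2) ^ 2) := by
        have e2 : κ = 2 * (1 + κ / 2) - 2 := by ring
        generalize 1 + κ / 2 = q at hq e2 ⊢
        rw [e2] at hkt ⊢
        generalize hs : 1 + (2 * q - 2) * t = s at hkt ⊢
        have e3 : (2 * q - 2) * t = s - 1 := by linarith
        rw [e3, div_mul_eq_mul_div, e3]
        field_simp
        ring
      rw [this]; positivity
    calc _ = x.im * (1 / (1 + κ / 2) + κ / 2 / (1 + κ / 2) ^ 2 - κ / (1 + κ / 2) ^ 2 * t) := by ring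
      _ ≤ _ := mul_le_mul_of_nonneg_left h6 h

/-! ### Only `f₁`, `f₂` and `f₃` compete -/

lemma f_sq_le {x : ℂ} (hx : ‖x‖ < 1) {j k : ℕ} (hk : 1 ≤ k) (hj : k ≤ j) :
    f j x ^ 2 ≤ ‖x‖ ^ k * (Real.pi ^ 2 / 6 / k ^ 2) := by
  rw [f_sq, re_csqrt_sq]
  have h1 : ‖x ^ j‖ ≤ ‖x‖ ^ k := by
    rw [norm_pow]; exact pow_le_pow_of_le_one (norm_nonneg _) hx.le hj
  have h2 : ‖Li2 (x ^ j)‖ ≤ ‖x‖ ^ k * (Real.pi ^ 2 / 6) :=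
    (norm_Li2_le (h1.trans (pow_le_one₀ (norm_nonneg _) hx.le))).trans (by gcongr)
  have h3 := Complex.re_le_norm (Li2 (x ^ j))
  have hk' : (0 : ℝ) < k := by exact_mod_cast hk
  rw [← mul_div_assoc]
  gcongr
  linarith

/-- In `(Re √z)² = (|z| + Re z) / 2` the second summand is nonpositive here, which halves the
general bound `π² / 96`. -/
lemma f_four_sq_le {x : ℂ} (hx : ‖x‖ < 1) (h : (x ^ 4).re ≤ 0) :
    f 4 x ^ 2 ≤ ‖x‖ ^ 4 * (Real.pi ^ 2 / 192) := by
  rw [f_sq, re_csqrt_sq]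
  have h1 : ‖x ^ 4‖ < 1 := by
    rw [norm_pow]; exact pow_lt_one₀ (norm_nonneg _) hx (by norm_num)
  have h2 := norm_Li2_le h1.le
  have h3 := re_Li2_nonpos h1 h
  rw [norm_pow] at h2
  push_cast
  linarith

lemma pi_sq_lt : Real.pi ^ 2 < 9.87 := by
  nlinarith [Real.pi_lt_d4, Real.pi_pos]

-- The upper half-disk is cut into sectors by the signs of `Re x`, of `u² - v²` and of `Re x⁴`. In
-- each, an upper bound for `f_j²` of size `r⁴` is beaten by a lower bound for `Re Li₂ + lam · Im
-- Li₂`, through the tangent half-plane of slope parameter `lam` in `sq_lt_re_csqrt_sq`. The term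
-- `f_1` wins for `Re x ≥ 0` or `|Re x| ≤ Im x`, and `f_2` wins near the negative axis.
set_option maxHeartbeats 1000000 in
theorem f_lt_f_one_or_f_two {x : ℂ} (hx : x ∈ upperHalfDisk) {j : ℕ} (hj : 4 ≤ j) :
    f j x < f 1 x ∨ f j x < f 2 x := by
  obtain ⟨hx1, hv⟩ := hx
  have hpi := pi_sq_lt
  set r := ‖x‖ with hr
  set u := x.re with hu
  set v := x.im with hv'
  have hr2 : r ^ 2 = u ^ 2 + v ^ 2 := by
    rw [hr, Complex.sq_norm, Complex.normSq_apply]; ring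
  have hr0 : 0 < r := norm_pos_iff.2 (by rintro rfl; simp [hv'] at hv)
  have hr41 : r ^ 4 ≤ r := pow_le_of_le_one hr0.le hx1.le (by norm_num)
  have hr21 : r ^ 2 ≤ r := pow_le_of_le_one hr0.le hx1.le (by norm_num)
  have hr42 : r ^ 4 ≤ r ^ 2 := pow_le_pow_of_le_one hr0.le hx1.le (by norm_num)
  have hr54 : r ^ 5 ≤ r ^ 4 := pow_le_pow_of_le_one hr0.le hx1.le (by norm_num)
  have hr4 : 0 < r ^ 4 := by positivity
  have hcrude : f j x ^ 2 ≤ r ^ 4 * (9.87 / 96) := by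
    refine (f_sq_le hx1 (by norm_num) hj).trans ?_
    push_cast
    refine mul_le_mul_of_nonneg_left ?_ hr4.le
    linarith
  -- The sharper constant is `π² / 150`, coming from `j ≥ 5`; the case `j = 4` has `π² / 192` by the
  -- sign of `Re x⁴`.
  have hfine : (x ^ 4).re ≤ 0 → f j x ^ 2 ≤ r ^ 4 * (9.87 / 150) := by
    intro h
    rcases hj.eq_or_lt with rfl | hj'
    · exact (f_four_sq_le hx1 h).trans (mul_le_mul_of_nonneg_left (by linarith) hr4.le)
    · refine (f_sq_le hx1 (by norm_num) hj').trans ?_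
      push_cast
      exact mul_le_mul hr54 (by linarith) (by positivity) hr4.le
  have hx4 : (x ^ 4).re = r ^ 4 - 8 * u ^ 2 * v ^ 2 := by
    have : r ^ 4 = (u ^ 2 + v ^ 2) ^ 2 := by rw [← hr2]; ring
    rw [this, show x ^ 4 = (x * x) * (x * x) by ring]
    simp only [Complex.mul_re, Complex.mul_im]
    ring
  have via1 : ∀ B lam : ℝ, f j x ^ 2 ≤ B → B * (1 + lam ^ 2) < (Li2 x).re + lam * (Li2 x).im →
      f j x < f 1 x := by
    intro B lam h1 h2
    refine lt_of_pow_lt_pow_left₀ 2 (f_nonneg _ _) (h1.trans_lt ?_)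
    rw [f_sq]
    simpa using sq_lt_re_csqrt_sq lam h2
  have hDsq : ‖1 - x‖ ^ 2 = 1 - 2 * u + r ^ 2 := by
    rw [hr2, Complex.sq_norm, Complex.normSq_apply]; simp; ring
  have him : ∀ D : ℝ, 0 ≤ D → 1 - 2 * u + r ^ 2 ≤ D ^ 2 → 2 * v / (1 + D) ≤ (Li2 x).im := by
    intro D hD h
    refine le_trans ?_ (le_im_Li2 hx1 hv.le)
    have : ‖1 - x‖ ≤ D := by
      refine le_of_sq_le_sq ?_ hD
      rwa [hDsq]
    gcongr
  have hre := re_sub_le_re_Li2 hx1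
  by_cases hu0 : 0 ≤ u
  · left
    refine via1 _ 1 hcrude ?_
    have h1 := him 1.4143 (by norm_num) (by linarith)
    have h2 : r ≤ u + v := le_of_sq_le_sq (by nlinarith) (by linarith)
    have h3 : 0.828 * v ≤ 2 * v / (1 + 1.4143) := by rw [le_div_iff₀ (by norm_num)]; linarith
    linarith
  push Not at hu0
  by_cases huv : u ^ 2 ≤ v ^ 2
  · left
    by_cases h4 : (x ^ 4).re ≤ 0
    · refine via1 _ 4 (hfine h4) ?_
      -- The decimals round `cos (π/4)` outwards; `1.848` then bounds `|1 - x| ≤ √(2 + √2)`.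
      have hu' : -u ≤ 0.7072 * r := le_of_sq_le_sq (by rw [mul_pow, hr2]; linarith) (by linarith)
      have hv2 : 0.707 * r ≤ v := le_of_sq_le_sq (by rw [mul_pow, hr2]; linarith) hv.le
      have h1 := neg_mul_norm_le_re_Li2 hx1 (κ := 0.7072) (by norm_num) (by norm_num)
        (by linarith)
      have h2 := him 1.848 (by norm_num) (by linarith)
      have h3 : 0.702 * v ≤ 2 * v / (1 + 1.848) := by rw [le_div_iff₀ (by norm_num)]; linarith
      linarith
    · refine via1 _ 2 hcrude ?_
      rw [hx4] at h4
      push Not at h4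
      -- `0.1465` is just above `sin² (π/8)`: `Re x⁴ > 0` with `u² ≤ v²` confines `x` to within
      -- angle `π/8` of the imaginary axis.
      have hu2 : u ^ 2 ≤ 0.1465 * r ^ 2 := by
        by_contra hc
        push Not at hc
        have h6 : r ^ 4 = r ^ 2 * r ^ 2 := by ring
        have h7 : v ^ 2 = r ^ 2 - u ^ 2 := by linarith
        have h8 : u ^ 2 ≤ r ^ 2 / 2 := by linarith
        rw [h7, h6] at h4
        generalize u ^ 2 = U at *
        generalize r ^ 2 = R at *
        nlinarith [mul_nonneg (sub_nonneg.2 h8) (sub_nonneg.2 hc.le)]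
      have hu' : -u ≤ 0.3828 * r := le_of_sq_le_sq (by rw [mul_pow]; linarith) (by linarith)
      have hv2 : 0.923 * r ≤ v := le_of_sq_le_sq (by rw [mul_pow]; linarith) hv.le
      have h2 := him 1.664 (by norm_num) (by linarith)
      have h3 : 0.75 * v ≤ 2 * v / (1 + 1.664) := by rw [le_div_iff₀ (by norm_num)]; linarith
      linarith
  · right
    push Not at huv
    -- In this sector `x²` lies in the lower half-plane; conjugation moves it to where `le_im_Li2`
    -- applies and leaves `Re √Li₂` unchanged.
    set y := (starRingEnd ℂ) (x ^ 2) with hy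
    have hyn : ‖y‖ = r ^ 2 := by rw [hy, Complex.norm_conj, norm_pow]
    have hy1 : ‖y‖ < 1 := by rw [hyn]; nlinarith
    have hyre : y.re = u ^ 2 - v ^ 2 := by
      rw [hy, Complex.conj_re, pow_two, Complex.mul_re]; ring
    have hyim : y.im = -(2 * u * v) := by
      rw [hy, Complex.conj_im, pow_two, Complex.mul_im]; ring
    have hyim0 : 0 ≤ y.im := by rw [hyim]; nlinarith
    have hLi : (Li2 (x ^ 2)).re = (Li2 y).re ∧ (Li2 (x ^ 2)).im = -(Li2 y).im := by
      rw [hy, Li2_conj]; simp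
    have via2 : ∀ B lam : ℝ, f j x ^ 2 ≤ B →
        4 * B * (1 + lam ^ 2) < (Li2 y).re + lam * (Li2 y).im → f j x < f 2 x := by
      intro B lam h1 h2
      refine lt_of_pow_lt_pow_left₀ 2 (f_nonneg _ _) (h1.trans_lt ?_)
      rw [f_sq]
      have := sq_lt_re_csqrt_sq (z := Li2 (x ^ 2)) (B := 4 * B) (-lam)
        (by rw [hLi.1, hLi.2]; linarith)
      push_cast
      linarith
    have hre2 := re_sub_le_re_Li2 hy1
    rw [hyn, hyre] at hre2
    have hre2' : u ^ 2 - v ^ 2 - r ^ 4 / 4 ≤ (Li2 y).re := by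
      calc _ = u ^ 2 - v ^ 2 - (r ^ 2) ^ 2 / 4 := by ring
        _ ≤ _ := hre2
    have hc0 : 0 < u ^ 2 - v ^ 2 := by linarith
    have hr4e : r ^ 4 = (r ^ 2) ^ 2 := by ring
    have hsq : (u ^ 2 - v ^ 2) ^ 2 = (r ^ 2) ^ 2 - 4 * (u ^ 2 * v ^ 2) := by rw [hr2]; ring
    by_cases h4 : (x ^ 4).re ≤ 0
    · refine via2 _ 1.5 (hfine h4) ?_
      rw [hx4] at h4
      have h1 := le_im_Li2 hy1 hyim0
      have hD : ‖1 - y‖ ≤ 1.4143 := by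
        refine le_of_sq_le_sq ?_ (by norm_num)
        have : ‖1 - y‖ ^ 2 = 1 - 2 * y.re + ‖y‖ ^ 2 := by
          rw [Complex.sq_norm, Complex.sq_norm, Complex.normSq_apply, Complex.normSq_apply]
          simp; ring
        rw [this, hyre, hyn, ← hr4e]
        linarith
      have h2 : 0.828 * y.im ≤ (Li2 y).im := by
        refine le_trans ?_ h1
        rw [le_div_iff₀ (by positivity), mul_assoc]
        nlinarith [mul_le_mul_of_nonneg_left hD hyim0]
      have h3 : 0.707 * r ^ 2 ≤ y.im := by
        refine le_of_sq_le_sq ?_ hyim0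
        rw [hyim, mul_pow, ← hr4e]
        linarith
      have h5 : r ^ 2 ≤ (u ^ 2 - v ^ 2) + y.im := by
        refine le_of_sq_le_sq ?_ (by positivity)
        have : y.im ^ 2 = 4 * (u ^ 2 * v ^ 2) := by rw [hyim]; ring
        rw [add_sq, this, hsq]
        linarith [mul_nonneg hc0.le hyim0]
      linarith
    · refine via2 _ 0 hcrude ?_
      rw [hx4] at h4
      push Not at h4
      have h3 : 0.707 * r ^ 2 ≤ u ^ 2 - v ^ 2 := by
        refine le_of_sq_le_sq ?_ hc0.le
        rw [hsq, mul_pow, ← hr4e]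
        linarith
      linarith

/-! ### The generating function -/

/-- `∑_{m ≥ 1} (x^m / m) q^m / (1 - q^m)`, the logarithm of `∏_{i ≥ 1} (1 - x q^i)⁻¹`. -/
def logGen (x q : ℂ) : ℂ := ∑' m : ℕ, x ^ (m + 1) / ((m : ℂ) + 1) * (q ^ (m + 1) / (1 - q ^ (m + 1)))

lemma norm_natCast_succ (m : ℕ) : ‖(m : ℂ) + 1‖ = (m : ℝ) + 1 := by
  rw [← Nat.cast_add_one, Complex.norm_natCast]; push_cast; rfl

/-- Discarding the factor `m + 1` in the exponent of `q` decouples the double sum into a product of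
two geometric series. -/
lemma norm_pow_mul_div_succ_le {x q : ℂ} (hq : ‖q‖ ≤ 1) (i m : ℕ) :
    ‖(x * q ^ (i + 1)) ^ (m + 1) / ((m : ℂ) + 1)‖ ≤ ‖q‖ ^ (i + 1) * ‖x‖ ^ (m + 1) := by
  rw [norm_div, norm_natCast_succ, norm_pow, norm_mul, norm_pow, mul_pow]
  refine (div_le_self (by positivity) (by simp)).trans ?_
  rw [mul_comm]
  gcongr
  rw [← pow_mul]
  exact pow_le_pow_of_le_one (norm_nonneg _) hq (Nat.le_mul_of_pos_right _ (Nat.succ_pos m))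

lemma summable_pow_succ {r : ℝ} (h0 : 0 ≤ r) (h1 : r < 1) : Summable fun m : ℕ => r ^ (m + 1) :=
  (summable_nat_add_iff 1).2 (summable_geometric_of_lt_one h0 h1)

lemma hasSum_neg_log {z : ℂ} (hz : ‖z‖ < 1) :
    HasSum (fun m : ℕ => z ^ (m + 1) / ((m : ℂ) + 1)) (-Complex.log (1 - z)) := by
  have h := (hasSum_nat_add_iff' 1).2 (Complex.hasSum_taylorSeries_neg_log hz)
  simpa using h

lemma norm_mul_pow_lt {x q : ℂ} (hx : ‖x‖ < 1) (hq : ‖q‖ ≤ 1) (i : ℕ) : ‖x * q ^ i‖ < 1 := by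
  rw [norm_mul, norm_pow]
  exact mul_lt_one_of_nonneg_of_lt_one_left (norm_nonneg _) hx (pow_le_one₀ (norm_nonneg _) hq)

lemma norm_log_one_sub_mul_pow_le {x q : ℂ} (hx : ‖x‖ < 1) (hq : ‖q‖ ≤ 1) (i : ℕ) :
    ‖-Complex.log (1 - x * q ^ (i + 1))‖ ≤ ‖q‖ ^ (i + 1) * ∑' m : ℕ, ‖x‖ ^ (m + 1) := by
  rw [← (hasSum_neg_log (norm_mul_pow_lt hx hq (i + 1))).tsum_eq, ← tsum_mul_left]
  exact tsum_of_norm_bounded ((summable_pow_succ (norm_nonneg _) hx).mul_left _).hasSum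
    (fun m => norm_pow_mul_div_succ_le hq i m)

/-- Expand `q^m / (1 - q^m)` geometrically and exchange the two absolutely convergent sums; the sum
over `m` is then the logarithm series. -/
lemma hasSum_logGen {x q : ℂ} (hx : ‖x‖ < 1) (hq : ‖q‖ < 1) :
    HasSum (fun i : ℕ => -Complex.log (1 - x * q ^ (i + 1))) (logGen x q) := by
  have hs : Summable (Function.uncurry fun (i m : ℕ) =>
      (x * q ^ (i + 1)) ^ (m + 1) / ((m : ℂ) + 1)) :=
    Summable.of_norm_bounded (g := fun p : ℕ × ℕ => ‖q‖ ^ (p.1 + 1) * ‖x‖ ^ (p.2 + 1))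
      ((summable_pow_succ (norm_nonneg _) hq).mul_of_nonneg (summable_pow_succ (norm_nonneg _) hx)
        (fun _ => by positivity) (fun _ => by positivity))
      (fun p => norm_pow_mul_div_succ_le hq.le p.1 p.2)
  have h1 : ∀ m : ℕ, x ^ (m + 1) / ((m : ℂ) + 1) * (q ^ (m + 1) / (1 - q ^ (m + 1))) =
      ∑' i : ℕ, (x * q ^ (i + 1)) ^ (m + 1) / ((m : ℂ) + 1) := by
    intro m
    have hqm : ‖q ^ (m + 1)‖ < 1 := by
      rw [norm_pow]; exact pow_lt_one₀ (norm_nonneg _) hq (by simp)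
    rw [div_eq_mul_inv (q ^ (m + 1)), ← tsum_geometric_of_norm_lt_one hqm, ← tsum_mul_left,
      ← tsum_mul_left]
    refine tsum_congr fun i => ?_
    rw [mul_pow, ← pow_mul, ← pow_mul, ← pow_add, show (i + 1) * (m + 1) = m + 1 + (m + 1) * i by ring]
    ring
  have h2 : logGen x q = ∑' i : ℕ, -Complex.log (1 - x * q ^ (i + 1)) := by
    rw [logGen, tsum_congr h1, hs.tsum_comm]
    exact tsum_congr fun i => (hasSum_neg_log (norm_mul_pow_lt hx hq.le (i + 1))).tsum_eq
  rw [h2]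
  exact (Summable.of_norm_bounded ((summable_pow_succ (norm_nonneg _) hq).mul_right _)
    (fun i => norm_log_one_sub_mul_pow_le hx hq.le i)).hasSum

lemma exp_sum_neg_log {x q : ℂ} (hx : ‖x‖ < 1) (hq : ‖q‖ ≤ 1) (N : ℕ) :
    Complex.exp (∑ i ∈ Finset.range N, -Complex.log (1 - x * q ^ (i + 1))) =
      ∏ i ∈ Finset.range N, (1 - x * q ^ (i + 1))⁻¹ := by
  rw [Complex.exp_sum]
  refine Finset.prod_congr rfl fun i _ => ?_
  rw [Complex.exp_neg, Complex.exp_log (one_sub_ne_zero (norm_mul_pow_lt hx hq _))]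

lemma norm_prod_inv_le {x q : ℂ} (hx : ‖x‖ < 1) (hq : ‖q‖ < 1) (N : ℕ) :
    ‖∏ i ∈ Finset.range N, (1 - x * q ^ (i + 1))⁻¹‖ ≤
      Real.exp (∑' i : ℕ, ‖q‖ ^ (i + 1) * ∑' m : ℕ, ‖x‖ ^ (m + 1)) := by
  rw [← exp_sum_neg_log hx hq.le, Complex.norm_exp, Real.exp_le_exp]
  refine (Complex.re_le_norm _).trans ((norm_sum_le _ _).trans ?_)
  refine (Finset.sum_le_sum fun i _ => norm_log_one_sub_mul_pow_le hx hq.le i).trans ?_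
  refine Summable.sum_le_tsum _ (fun i _ => ?_)
    ((summable_pow_succ (norm_nonneg _) hq).mul_right _)
  have : 0 ≤ ∑' m : ℕ, ‖x‖ ^ (m + 1) := tsum_nonneg fun m => by positivity
  positivity

lemma tendsto_prod_inv {x q : ℂ} (hx : ‖x‖ < 1) (hq : ‖q‖ < 1) :
    Tendsto (fun N : ℕ => ∏ i ∈ Finset.range N, (1 - x * q ^ (i + 1))⁻¹) atTop
      (𝓝 (Complex.exp (logGen x q))) := by
  simp_rw [← exp_sum_neg_log hx hq.le]
  exact (Complex.continuous_exp.tendsto _).comp (hasSum_logGen hx hq).tendsto_sum_nat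

/-- The power series `φ` converges absolutely to `g` on the open unit disk. -/
def Represents (φ : PowerSeries ℂ) (g : ℂ → ℂ) : Prop :=
  ∀ q : ℂ, ‖q‖ < 1 → Summable (fun n => ‖φ.coeff n * q ^ n‖) ∧
    ∑' n, φ.coeff n * q ^ n = g q

lemma Represents.mul {φ ψ : PowerSeries ℂ} {g h : ℂ → ℂ} (hφ : Represents φ g)
    (hψ : Represents ψ h) : Represents (φ * ψ) (fun q => g q * h q) := by
  intro q hq
  obtain ⟨h1, h2⟩ := hφ q hq
  obtain ⟨h3, h4⟩ := hψ q hq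
  have key : ∀ n, (φ * ψ).coeff n * q ^ n =
      ∑ kl ∈ Finset.HasAntidiagonal.antidiagonal n, (φ.coeff kl.1 * q ^ kl.1) * (ψ.coeff kl.2 * q ^ kl.2) := by
    intro n
    rw [PowerSeries.coeff_mul, Finset.sum_mul]
    refine Finset.sum_congr rfl fun p hp => ?_
    rw [← Finset.HasAntidiagonal.mem_antidiagonal.1 hp, pow_add]
    ring
  constructor
  · have := summable_norm_sum_mul_antidiagonal_of_summable_norm h1 h3
    exact this.congr fun n => by rw [key n]
  · have := tsum_mul_tsum_eq_tsum_sum_antidiagonal_of_summable_norm h1 h3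
    rw [h2, h4] at this
    rw [tsum_congr key]
    exact this.symm

lemma Represents.one : Represents 1 (fun _ => 1) := by
  intro q _
  have : ∀ n : ℕ, (1 : PowerSeries ℂ).coeff n * q ^ n = if n = 0 then 1 else 0 := by
    intro n
    rw [PowerSeries.coeff_one]
    split_ifs with h <;> simp [h]
  simp_rw [this]
  constructor
  · refine summable_of_ne_finset_zero (s := {0}) fun n hn => ?_
    simp at hn
    simp [hn]
  · simp

lemma Represents.prod {φ : ℕ → PowerSeries ℂ} {g : ℕ → ℂ → ℂ} (h : ∀ i, Represents (φ i) (g i))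
    (N : ℕ) : Represents (∏ i ∈ Finset.range N, φ i) (fun q => ∏ i ∈ Finset.range N, g i q) := by
  induction N with
  | zero => simpa using Represents.one
  | succ N ih =>
    simp_rw [Finset.prod_range_succ]
    exact ih.mul (h N)

-- The factor is the geometric series in `x q^{i+1}`: the index `j` stands for multiplicity `j + 1`
-- of the part `i + 1`, and the leading `1` for multiplicity zero.
open scoped PowerSeries.WithPiTopology in
lemma coeff_genFun_factor (x : ℂ) (i n : ℕ) :
    (1 + ∑' j : ℕ, (x ^ (j + 1)) • (PowerSeries.X : PowerSeries ℂ) ^ ((i + 1) * (j + 1))).coeff n =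
      if (i + 1) ∣ n then x ^ (n / (i + 1)) else 0 := by
  rw [map_add, (Nat.Partition.summable_genFun_term (fun _ c => x ^ c) i).map_tsum _
    (PowerSeries.WithPiTopology.continuous_coeff _ _)]
  simp only [map_smul, PowerSeries.coeff_X_pow, PowerSeries.coeff_one, smul_eq_mul, mul_ite,
    mul_one, mul_zero]
  rcases Nat.eq_zero_or_pos n with rfl | hn
  · simp
  · rw [if_neg hn.ne', zero_add]
    split_ifs with h
    · obtain ⟨c, rfl⟩ := h
      obtain ⟨c, rfl⟩ := Nat.exists_eq_add_one_of_ne_zero (n := c) (by rintro rfl; simp at hn)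
      rw [tsum_eq_single c]
      · simp
      · intro b hb
        rw [if_neg]
        intro h
        have := Nat.eq_of_mul_eq_mul_left (Nat.succ_pos i) h
        omega
    · refine (tsum_congr fun j => if_neg ?_).trans tsum_zero
      rintro rfl
      exact h (dvd_mul_right _ _)

open scoped PowerSeries.WithPiTopology in
lemma represents_genFun_factor {x : ℂ} (hx : ‖x‖ < 1) (i : ℕ) :
    Represents (1 + ∑' j : ℕ, (x ^ (j + 1)) • (PowerSeries.X : PowerSeries ℂ) ^ ((i + 1) * (j + 1)))
      (fun q => (1 - x * q ^ (i + 1))⁻¹) := by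
  intro q hq
  simp_rw [coeff_genFun_factor]
  have hinj : Function.Injective fun c : ℕ => (i + 1) * c := fun a b h =>
    Nat.eq_of_mul_eq_mul_left (Nat.succ_pos i) h
  have hz := norm_mul_pow_lt hx hq.le (i + 1)
  have hsupp : ∀ n ∉ Set.range (fun c : ℕ => (i + 1) * c),
      (if (i + 1) ∣ n then x ^ (n / (i + 1)) else 0) * q ^ n = 0 := by
    intro n hn
    rw [if_neg, zero_mul]
    rintro ⟨c, rfl⟩
    exact hn ⟨c, rfl⟩
  have hval : ∀ c : ℕ, (if (i + 1) ∣ (i + 1) * c then x ^ ((i + 1) * c / (i + 1)) else 0) *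
      q ^ ((i + 1) * c) = (x * q ^ (i + 1)) ^ c := by
    intro c
    rw [if_pos (dvd_mul_right _ _), Nat.mul_div_cancel_left _ (Nat.succ_pos i), mul_pow, pow_mul]
  constructor
  · rw [← hinj.summable_iff (fun n hn => by rw [hsupp n hn, norm_zero])]
    have : Summable fun c : ℕ => ‖x * q ^ (i + 1)‖ ^ c :=
      summable_geometric_of_lt_one (norm_nonneg _) hz
    refine this.congr fun c => ?_
    simp only [Function.comp_apply]
    rw [hval, norm_pow]
  · have h := hasSum_geometric_of_norm_lt_one hz
    refine HasSum.tsum_eq ?_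
    rw [← hinj.hasSum_iff hsupp]
    refine h.congr_fun ?_
    intro c
    simp only [Function.comp_apply]
    rw [hval]

/-- The exponents `c` are multiplicities, and they add up to the number of parts. For `n = 0` the
empty partition would count on the left but not in `F`. -/
lemma coeff_genFun_eq_eval_F (x : ℂ) {n : ℕ} (hn : 1 ≤ n) :
    (Nat.Partition.genFun (fun _ c => x ^ c)).coeff n = (F n).eval x := by
  rw [Nat.Partition.coeff_genFun]
  have h1 : ∀ p : n.Partition, (p.parts.toFinsupp.prod fun _ c => x ^ c) = x ^ p.parts.card := by
    intro p
    rw [Finsupp.prod, Finset.prod_pow_eq_pow_sum]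
    congr 1
    simp [Multiset.toFinsupp_support]
  simp_rw [h1]
  have hcard : ∀ p : n.Partition, p.parts.card ∈ Finset.Icc 1 n := by
    intro p
    rw [Finset.mem_Icc]
    constructor
    · rw [Nat.one_le_iff_ne_zero]
      intro h
      have h2 := p.parts_sum
      rw [Multiset.card_eq_zero.1 h] at h2
      simp at h2
      omega
    · have := Multiset.card_nsmul_le_sum (s := p.parts) (a := 1) (fun y hy => p.parts_pos hy)
      rw [p.parts_sum] at this
      simpa using this
  rw [← Finset.sum_fiberwise_of_maps_to (g := fun p : n.Partition => p.parts.card)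
    (fun p _ => hcard p), F, Polynomial.eval_finsetSum]
  refine Finset.sum_congr rfl fun k _ => ?_
  rw [Finset.sum_congr rfl (g := fun _ => x ^ k)]
  · simp [numPartitions]
  · intro p hp
    rw [(Finset.mem_filter.1 hp).2]

/-! ### Coefficient extraction -/

/-- The point `e^{-σ + iθ}`. -/
def circlePt (σ θ : ℝ) : ℂ := Complex.exp (-(σ : ℂ) + θ * Complex.I)

lemma norm_circlePt (σ θ : ℝ) : ‖circlePt σ θ‖ = Real.exp (-σ) := by
  rw [circlePt, Complex.norm_exp]; simp

lemma norm_circlePt_lt {σ : ℝ} (hσ : 0 < σ) (θ : ℝ) : ‖circlePt σ θ‖ < 1 := by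
  rw [norm_circlePt]; simpa using hσ

lemma continuous_circlePt (σ : ℝ) : Continuous (circlePt σ) := by
  unfold circlePt; fun_prop

lemma integral_circlePt_pow (σ a : ℝ) (m n : ℕ) :
    ∫ θ in a..a + 2 * Real.pi, circlePt σ θ ^ m * Complex.exp (n * (σ - θ * Complex.I)) =
      if m = n then 2 * Real.pi else 0 := by
  have h : ∀ θ : ℝ, circlePt σ θ ^ m * Complex.exp (n * (σ - θ * Complex.I)) =
      Complex.exp (((n : ℂ) - m) * σ) * Complex.exp ((((m : ℂ) - n) * Complex.I) * θ) := by
    intro θ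
    rw [circlePt, ← Complex.exp_nat_mul, ← Complex.exp_add, ← Complex.exp_add]
    congr 1; ring
  simp_rw [h]
  rw [intervalIntegral.integral_const_mul]
  split_ifs with hmn
  · subst hmn
    simp
  · have hc : ((m : ℂ) - n) * Complex.I ≠ 0 :=
      mul_ne_zero (sub_ne_zero.2 (by exact_mod_cast hmn)) Complex.I_ne_zero
    rw [integral_exp_mul_complex hc]
    have : Complex.exp (((m : ℂ) - n) * Complex.I * ((a + 2 * Real.pi : ℝ) : ℂ)) =
        Complex.exp (((m : ℂ) - n) * Complex.I * a) := by
      rw [Complex.exp_eq_exp_iff_exists_int]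
      refine ⟨(m : ℤ) - n, ?_⟩
      push_cast; ring
    rw [this]; simp

lemma Represents.integral_eq {φ : PowerSeries ℂ} {g : ℂ → ℂ} (h : Represents φ g) {σ : ℝ}
    (hσ : 0 < σ) (a : ℝ) (n : ℕ) :
    ∫ θ in a..a + 2 * Real.pi, g (circlePt σ θ) * Complex.exp (n * (σ - θ * Complex.I)) =
      2 * Real.pi * φ.coeff n := by
  have hb : ∀ (m : ℕ) (θ : ℝ),
      ‖φ.coeff m * (circlePt σ θ ^ m * Complex.exp (n * (σ - θ * Complex.I)))‖ =
        ‖φ.coeff m * circlePt σ 0 ^ m‖ * Real.exp (n * σ) := by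
    intro m θ
    have : ‖Complex.exp (n * (σ - θ * Complex.I))‖ = Real.exp (n * σ) := by
      rw [Complex.norm_exp]; simp
    rw [norm_mul, norm_mul, norm_mul, norm_pow, norm_pow, norm_circlePt, norm_circlePt, this]
    ring
  have hsum := intervalIntegral.hasSum_integral_of_dominated_convergence (μ := MeasureTheory.volume)
    (a := a) (b := a + 2 * Real.pi)
    (F := fun (m : ℕ) θ => φ.coeff m * (circlePt σ θ ^ m * Complex.exp (n * (σ - θ * Complex.I))))
    (f := fun θ => g (circlePt σ θ) * Complex.exp (n * (σ - θ * Complex.I)))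
    (fun m _ => ‖φ.coeff m * circlePt σ 0 ^ m‖ * Real.exp (n * σ)) ?_ ?_ ?_ ?_ ?_
  · simp_rw [intervalIntegral.integral_const_mul, integral_circlePt_pow] at hsum
    have h1 := hasSum_ite_eq n (φ.coeff n * (2 * Real.pi))
    rw [hsum.unique (h1.congr_fun ?_)]
    · ring
    · intro m
      split_ifs with hm
      · rw [hm]; push_cast; ring
      · simp
  · intro m
    refine Continuous.aestronglyMeasurable ?_
    have := continuous_circlePt σ
    fun_prop
  · intro m
    exact Filter.Eventually.of_forall fun θ _ => (hb m θ).le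
  · exact Filter.Eventually.of_forall fun θ _ =>
      (h _ (norm_circlePt_lt hσ 0)).1.mul_right _
  · exact intervalIntegrable_const
  · refine Filter.Eventually.of_forall fun θ _ => ?_
    obtain ⟨h1, h2⟩ := h _ (norm_circlePt_lt hσ θ)
    have := (h1.of_norm.hasSum.mul_right (Complex.exp (n * (σ - θ * Complex.I))))
    rw [h2] at this
    simpa only [mul_assoc] using this

-- Cauchy's formula is used only for finite partial products. Their coefficients converge to those
-- of the generating function, and their integrals converge by domination, so the two limits agree.
open scoped PowerSeries.WithPiTopology in
theorem integral_exp_logGen {x : ℂ} (hx : ‖x‖ < 1) {σ : ℝ} (hσ : 0 < σ) (a : ℝ) {n : ℕ}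
    (hn : 1 ≤ n) :
    ∫ θ in a..a + 2 * Real.pi,
      Complex.exp (logGen x (circlePt σ θ)) * Complex.exp (n * (σ - θ * Complex.I)) =
      2 * Real.pi * (F n).eval x := by
  have h1 : ∀ N : ℕ, _ := fun N =>
    (Represents.prod (fun i => represents_genFun_factor hx i) N).integral_eq hσ a n
  have h2 := Nat.Partition.hasProd_genFun (R := ℂ) (fun _ c => x ^ c)
  have h3 := ((PowerSeries.WithPiTopology.tendsto_iff_coeff_tendsto _ _ _ _).1
    (HasProd.tendsto_prod_nat h2) n).const_mul (2 * Real.pi : ℂ)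
  rw [coeff_genFun_eq_eval_F x hn] at h3
  refine tendsto_nhds_unique ?_ h3
  simp_rw [← h1]
  set C := Real.exp (∑' i : ℕ, Real.exp (-σ) ^ (i + 1) * ∑' m : ℕ, ‖x‖ ^ (m + 1))
  refine intervalIntegral.tendsto_integral_filter_of_dominated_convergence
    (fun _ => C * Real.exp (n * σ)) ?_ ?_ ?_ ?_
  · refine Filter.Eventually.of_forall fun N => Continuous.aestronglyMeasurable ?_
    have hc := continuous_circlePt σ
    refine Continuous.mul ?_ (by fun_prop)
    refine continuous_finsetProd _ fun i _ => Continuous.inv₀ (by fun_prop) fun θ => ?_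
    exact one_sub_ne_zero (norm_mul_pow_lt hx (norm_circlePt_lt hσ θ).le _)
  · refine Filter.Eventually.of_forall fun N => Filter.Eventually.of_forall fun θ _ => ?_
    have h5 : ‖Complex.exp (n * (σ - θ * Complex.I))‖ = Real.exp (n * σ) := by
      rw [Complex.norm_exp]; simp
    rw [norm_mul, h5]
    have := norm_prod_inv_le hx (norm_circlePt_lt hσ θ) N
    rw [norm_circlePt] at this
    gcongr
  · exact intervalIntegrable_const
  · refine Filter.Eventually.of_forall fun θ _ => ?_
    exact (tendsto_prod_inv hx (norm_circlePt_lt hσ θ)).mul_const _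

/-! ### The kernel `1 / (ξ e^z - 1)` -/

lemma re_le_norm_mul_exp_sub_one {ξ z : ℂ} (hξ : ‖ξ‖ = 1) :
    z.re ≤ ‖ξ * Complex.exp z - 1‖ := by
  have h1 : ‖ξ * Complex.exp z‖ - ‖(1 : ℂ)‖ ≤ ‖ξ * Complex.exp z - 1‖ := norm_sub_norm_le _ _
  rw [norm_mul, hξ, one_mul, Complex.norm_exp, norm_one] at h1
  linarith [Real.add_one_le_exp z.re]

lemma norm_one_div_mul_exp_sub_one_le {ξ z : ℂ} (hξ : ‖ξ‖ = 1) (hz : 0 < z.re) :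
    ‖1 / (ξ * Complex.exp z - 1)‖ ≤ 1 / z.re := by
  rw [norm_div, norm_one]
  exact one_div_le_one_div_of_le hz (re_le_norm_mul_exp_sub_one hξ)

lemma norm_le_of_sector {z : ℂ} {M : ℝ} (hz : 0 < z.re) (h : |z.im| ≤ M * z.re) :
    ‖z‖ ≤ (1 + M) * z.re := by
  have := Complex.norm_le_abs_re_add_abs_im z
  rw [abs_of_pos hz] at this
  linarith

lemma norm_bernoulli_kernel_le {z : ℂ} (hz0 : z ≠ 0) (hz : ‖z‖ ≤ 1 / 2) :
    ‖1 / (Complex.exp z - 1) - 1 / z + 1 / 2‖ ≤ 2 * ‖z‖ := by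
  have hR := Complex.exp_bound (x := z) (by linarith) (n := 3) (by norm_num)
  set R := Complex.exp z - ∑ m ∈ Finset.range 3, z ^ m / (m.factorial : ℂ) with hRdef
  have hexp : Complex.exp z = 1 + z + z ^ 2 / 2 + R := by
    rw [hRdef]; simp [Finset.sum_range_succ, Nat.factorial]
  have hR' : ‖R‖ ≤ ‖z‖ ^ 3 * (2 / 9) := by
    refine hR.trans (le_of_eq ?_)
    norm_num [Nat.factorial]
  have hn : 0 < ‖z‖ := norm_pos_iff.2 hz0
  have h1 : ‖z‖ / 2 ≤ ‖Complex.exp z - 1‖ := by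
    have h2 := Complex.norm_exp_sub_one_sub_id_le (x := z) (by linarith)
    have h3 : ‖z‖ - ‖Complex.exp z - 1‖ ≤ ‖z - (Complex.exp z - 1)‖ := norm_sub_norm_le _ _
    rw [norm_sub_rev z] at h3
    nlinarith
  have hne : Complex.exp z - 1 ≠ 0 := norm_pos_iff.1 (by linarith)
  have e : 1 / (Complex.exp z - 1) - 1 / z + 1 / 2 =
      (-R + z ^ 3 / 4 + z * R / 2) / (z * (Complex.exp z - 1)) := by
    field_simp
    rw [hexp]
    ring
  rw [e, norm_div, norm_mul, div_le_iff₀ (by positivity)]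
  have h4 : ‖-R + z ^ 3 / 4 + z * R / 2‖ ≤ ‖R‖ + ‖z‖ ^ 3 / 4 + ‖z‖ * ‖R‖ / 2 := by
    refine (norm_add_le _ _).trans (add_le_add ((norm_add_le _ _).trans (add_le_add ?_ ?_)) ?_)
    · rw [norm_neg]
    · simp
    · simp
  have h5 : ‖z‖ * ‖R‖ ≤ 1 / 2 * ‖R‖ := by gcongr
  have h6 : 2 * ‖z‖ * (‖z‖ * (‖z‖ / 2)) ≤ 2 * ‖z‖ * (‖z‖ * ‖Complex.exp z - 1‖) := by gcongr
  nlinarith [pow_pos hn 3]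

/-- The bound must hold on the whole sector, since it is applied at `z = (m + 1)τ` for every `m`.
For `|z| > 1/2` each of the three terms is bounded separately, using `1/|z| ≤ 4|z|` and `1/2 ≤ |z|`.
-/
lemma exists_bernoulli_kernel_bound (M : ℝ) (hM : 0 ≤ M) : ∃ C : ℝ, ∀ z : ℂ, 0 < z.re →
    |z.im| ≤ M * z.re → ‖1 / (Complex.exp z - 1) - 1 / z + 1 / 2‖ ≤ C * ‖z‖ := by
  refine ⟨2 + 4 * (1 + M) + 4 + 1, fun z hz hs => ?_⟩
  have hz0 : z ≠ 0 := by rintro rfl; simp at hz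
  have hn : 0 < ‖z‖ := norm_pos_iff.2 hz0
  by_cases h : ‖z‖ ≤ 1 / 2
  · refine (norm_bernoulli_kernel_le hz0 h).trans ?_
    gcongr
    linarith
  · push Not at h
    have h1 := norm_one_div_mul_exp_sub_one_le (ξ := 1) (by simp) hz
    rw [one_mul] at h1
    have h2 : 1 / z.re ≤ (1 + M) / ‖z‖ := by
      rw [div_le_div_iff₀ hz hn, one_mul]
      exact norm_le_of_sector hz hs
    have h3 : ‖1 / (Complex.exp z - 1) - 1 / z + 1 / 2‖ ≤ (1 + M) / ‖z‖ + 1 / ‖z‖ + 1 / 2 := by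
      refine (norm_add_le _ _).trans (add_le_add ((norm_sub_le _ _).trans (add_le_add ?_ ?_)) ?_)
      · exact h1.trans h2
      · rw [norm_div, norm_one]
      · simp
    have h4 : 1 / ‖z‖ ≤ 4 * ‖z‖ := by
      rw [div_le_iff₀ hn]; nlinarith
    have h5 : (1 + M) / ‖z‖ ≤ (1 + M) * (4 * ‖z‖) := by
      rw [div_eq_mul_one_div]; gcongr
    nlinarith

lemma exists_kernel_bound (M d : ℝ) (hM : 0 ≤ M) (hd : 0 < d) : ∃ C : ℝ, ∀ ξ z : ℂ, ‖ξ‖ = 1 →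
    d ≤ ‖ξ - 1‖ → 0 < z.re → |z.im| ≤ M * z.re →
      ‖1 / (ξ * Complex.exp z - 1) - 1 / (ξ - 1)‖ ≤ C * ‖z‖ := by
  -- `1` permits `|e^z - 1| ≤ 2|z|`, and `d / 4` then keeps `|ξ e^z - 1| ≥ d / 2`.
  set δ := min 1 (d / 4) with hδ
  have hδ0 : 0 < δ := by positivity
  refine ⟨4 / d ^ 2 + ((1 + M) / δ + 1 / d) / δ, fun ξ z hξ hd' hz hs => ?_⟩
  have hz0 : z ≠ 0 := by rintro rfl; simp at hz
  have hn : 0 < ‖z‖ := norm_pos_iff.2 hz0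
  by_cases h : ‖z‖ ≤ δ
  · have h1 : ‖Complex.exp z - 1‖ ≤ 2 * ‖z‖ :=
      Complex.norm_exp_sub_one_le (h.trans (min_le_left _ _))
    have h2 : ‖z‖ ≤ d / 4 := h.trans (min_le_right _ _)
    have h3 : d / 2 ≤ ‖ξ * Complex.exp z - 1‖ := by
      have e : ξ * Complex.exp z - 1 = (ξ - 1) - ξ * (1 - Complex.exp z) := by ring
      rw [e]
      have := norm_sub_norm_le (ξ - 1) (ξ * (1 - Complex.exp z))
      rw [norm_mul, hξ, one_mul, norm_sub_rev 1] at this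
      linarith
    have hne1 : ξ * Complex.exp z - 1 ≠ 0 := norm_pos_iff.1 (by linarith)
    have hne2 : ξ - 1 ≠ 0 := norm_pos_iff.1 (by linarith)
    have e : 1 / (ξ * Complex.exp z - 1) - 1 / (ξ - 1) =
        (ξ * (1 - Complex.exp z)) / ((ξ * Complex.exp z - 1) * (ξ - 1)) := by
      field_simp; ring
    rw [e, norm_div, norm_mul, norm_mul, hξ, one_mul, norm_sub_rev 1]
    calc ‖Complex.exp z - 1‖ / (‖ξ * Complex.exp z - 1‖ * ‖ξ - 1‖)
        ≤ (2 * ‖z‖) / (d / 2 * d) := by gcongr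
      _ = 4 / d ^ 2 * ‖z‖ := by field_simp; ring
      _ ≤ _ := by
        gcongr
        have : 0 ≤ ((1 + M) / δ + 1 / d) / δ := by positivity
        linarith
  · push Not at h
    have h1 := norm_one_div_mul_exp_sub_one_le hξ hz
    have h2 : 1 / z.re ≤ (1 + M) / ‖z‖ := by
      rw [div_le_div_iff₀ hz hn, one_mul]
      exact norm_le_of_sector hz hs
    have h3 : (1 + M) / ‖z‖ ≤ (1 + M) / δ := by gcongr
    have h4 : ‖1 / (ξ - 1)‖ ≤ 1 / d := by
      rw [norm_div, norm_one]; gcongr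
    calc ‖1 / (ξ * Complex.exp z - 1) - 1 / (ξ - 1)‖ ≤ (1 + M) / δ + 1 / d :=
          (norm_sub_le _ _).trans (by linarith)
      _ = ((1 + M) / δ + 1 / d) / δ * δ := by field_simp
      _ ≤ ((1 + M) / δ + 1 / d) / δ * ‖z‖ := by gcongr
      _ ≤ _ := by
        gcongr
        have : 0 ≤ 4 / d ^ 2 := by positivity
        linarith

lemma exists_dist_rootsOfUnity (k : ℕ) (hk : 0 < k) :
    ∃ d : ℝ, 0 < d ∧ ∀ ξ : ℂ, ξ ^ k = 1 → ξ ≠ 1 → d ≤ ‖ξ - 1‖ := by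
  have hfin : {ξ : ℂ | ξ ^ k = 1 ∧ ξ ≠ 1}.Finite := by
    refine (Polynomial.nthRootsFinset k (1 : ℂ)).finite_toSet.subset fun ξ hξ => ?_
    simpa [Polynomial.mem_nthRootsFinset hk] using hξ.1
  obtain ⟨d, hd, hball⟩ := Metric.isOpen_iff.1 hfin.isClosed.isOpen_compl 1 (by simp)
  refine ⟨d, hd, fun ξ h1 h2 => ?_⟩
  by_contra hlt
  push Not at hlt
  exact hball (mem_ball_iff_norm.2 hlt) ⟨h1, h2⟩

/-! ### Sums over multiples -/

/-- All series over `l ≥ 1` are indexed by `m = l - 1`, so the multiples of `k` sit at `m = k(c + 1)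
- 1`. -/
lemma hasSum_multiples {a : ℕ → ℂ} {s : ℂ} {k : ℕ} (hk : 0 < k)
    (h : HasSum (fun c : ℕ => a (k * (c + 1))) s) :
    HasSum (fun m : ℕ => if k ∣ m + 1 then a (m + 1) else 0) s := by
  have hpos : ∀ c : ℕ, 1 ≤ k * (c + 1) := fun c => Nat.succ_le_of_lt (by positivity)
  have hinj : Function.Injective fun c : ℕ => k * (c + 1) - 1 := by
    intro a b hab
    have h1 := hpos a
    have h2 := hpos b
    have h3 : k * (a + 1) = k * (b + 1) := by simp only at hab; omega
    have := Nat.eq_of_mul_eq_mul_left hk h3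
    omega
  rw [← hinj.hasSum_iff]
  · refine h.congr_fun fun c => ?_
    simp only [Function.comp_apply]
    rw [Nat.sub_add_cancel (hpos c), if_pos (dvd_mul_right _ _)]
  · intro m hm
    rw [if_neg]
    rintro ⟨c, hc⟩
    obtain ⟨c, rfl⟩ := Nat.exists_eq_add_one_of_ne_zero (n := c) (by rintro rfl; simp at hc)
    exact hm ⟨c, by simp only; omega⟩

lemma L_sq (k : ℕ) (x : ℂ) : L k x ^ 2 = Li2 (x ^ k) / (k : ℂ) ^ 2 := by
  rw [L, div_pow, csqrt_sq]

lemma hasSum_L_sq {x : ℂ} (hx : ‖x‖ < 1) (k : ℕ) :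
    HasSum (fun m : ℕ => if k ∣ m + 1 then x ^ (m + 1) / ((m : ℂ) + 1) ^ 2 else 0) (L k x ^ 2) := by
  -- For `k = 0` both sides vanish: `L 0 x = 0` by division by zero, and `0` divides no `m + 1`.
  -- This covers points that are not roots of unity, whose `orderOf` is `0`.
  rcases Nat.eq_zero_or_pos k with rfl | hk
  · simp [L_sq, hasSum_zero]
  · have hxk : ‖x ^ k‖ ≤ 1 := by rw [norm_pow]; exact pow_le_one₀ (norm_nonneg _) hx.le
    have h1 : HasSum (fun m : ℕ => (x ^ k) ^ (m + 1) / ((m : ℂ) + 1) ^ 2) (Li2 (x ^ k)) :=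
      (summable_norm_Li2 hxk).of_norm.hasSum
    have h2 := hasSum_multiples (a := fun n => x ^ n / (n : ℂ) ^ 2) (s := L k x ^ 2) hk (by
      rw [L_sq]
      refine (h1.div_const ((k : ℂ) ^ 2)).congr_fun fun c => ?_
      have : (k : ℂ) ≠ 0 := by exact_mod_cast hk.ne'
      have h' : (c : ℂ) + 1 ≠ 0 := Nat.cast_add_one_ne_zero c
      rw [pow_mul]
      push_cast
      field_simp)
    refine h2.congr_fun fun m => ?_
    push_cast
    rfl

lemma hasSum_log_multiples {x : ℂ} (hx : ‖x‖ < 1) {k : ℕ} (hk : 0 < k) :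
    HasSum (fun m : ℕ => if k ∣ m + 1 then x ^ (m + 1) / ((m : ℂ) + 1) else 0)
      (-Complex.log (1 - x ^ k) / k) := by
  have hxk : ‖x ^ k‖ < 1 := by rw [norm_pow]; exact pow_lt_one₀ (norm_nonneg _) hx hk.ne'
  have h2 := hasSum_multiples (a := fun n => x ^ n / (n : ℂ))
      (s := -Complex.log (1 - x ^ k) / k) hk (by
    refine ((hasSum_neg_log hxk).div_const (k : ℂ)).congr_fun fun c => ?_
    have : (k : ℂ) ≠ 0 := by exact_mod_cast hk.ne'
    have h' : (c : ℂ) + 1 ≠ 0 := Nat.cast_add_one_ne_zero c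
    rw [pow_mul]
    push_cast
    field_simp)
  refine h2.congr_fun fun m => ?_
  push_cast
  rfl

/-! ### The behaviour of `logGen` near roots of unity -/

lemma circlePt_pow_div {σ : ℝ} (hσ : 0 < σ) (θ : ℝ) (m : ℕ) :
    circlePt σ θ ^ (m + 1) / (1 - circlePt σ θ ^ (m + 1)) =
      1 / (Complex.exp (((m : ℂ) + 1) * (σ - θ * Complex.I)) - 1) := by
  have h1 : circlePt σ θ ^ (m + 1) = (Complex.exp (((m : ℂ) + 1) * (σ - θ * Complex.I)))⁻¹ := by
    rw [circlePt, ← Complex.exp_nat_mul, ← Complex.exp_neg]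
    congr 1; push_cast; ring
  have h2 : ‖circlePt σ θ ^ (m + 1)‖ < 1 := by
    rw [norm_pow]; exact pow_lt_one₀ (norm_nonneg _) (norm_circlePt_lt hσ θ) (by simp)
  have h3 := one_sub_ne_zero h2
  rw [h1] at h3 ⊢
  have h4 := Complex.exp_ne_zero (((m : ℂ) + 1) * (σ - θ * Complex.I))
  have h5 : Complex.exp (((m : ℂ) + 1) * (σ - θ * Complex.I)) - 1 ≠ 0 := by
    intro h
    rw [sub_eq_zero.1 h] at h3
    simp at h3
  field_simp

lemma norm_kernel_circlePt_le {σ : ℝ} (hσ : 0 < σ) (θ : ℝ) (m : ℕ) :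
    ‖1 / (Complex.exp (((m : ℂ) + 1) * (σ - θ * Complex.I)) - 1)‖ ≤ 1 / (((m : ℝ) + 1) * σ) := by
  have hre : ((((m : ℂ) + 1) * (σ - θ * Complex.I))).re = ((m : ℝ) + 1) * σ := by simp
  have := norm_one_div_mul_exp_sub_one_le (ξ := 1)
    (z := (((m : ℂ) + 1) * (σ - θ * Complex.I))) (by simp) (by rw [hre]; positivity)
  rwa [one_mul, hre] at this

lemma norm_logGen_term_le {x : ℂ} {σ : ℝ} (hσ : 0 < σ) (θ : ℝ) (m : ℕ) :
    ‖x ^ (m + 1) / ((m : ℂ) + 1) * (1 / (Complex.exp (((m : ℂ) + 1) * (σ - θ * Complex.I)) - 1))‖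
      ≤ ‖x‖ ^ (m + 1) / σ := by
  rw [norm_mul, norm_div, norm_pow, norm_natCast_succ]
  calc _ ≤ ‖x‖ ^ (m + 1) / 1 * (1 / (1 * σ)) := by
        refine mul_le_mul ?_ ((norm_kernel_circlePt_le hσ θ m).trans ?_) (norm_nonneg _)
          (by positivity)
        · gcongr; simp
        · gcongr; simp
    _ = _ := by ring

lemma hasSum_logGen_circlePt {x : ℂ} (hx : ‖x‖ < 1) {σ : ℝ} (hσ : 0 < σ) (θ : ℝ) :
    HasSum (fun m : ℕ => x ^ (m + 1) / ((m : ℂ) + 1) *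
      (1 / (Complex.exp (((m : ℂ) + 1) * (σ - θ * Complex.I)) - 1)))
      (logGen x (circlePt σ θ)) := by
  unfold logGen
  simp_rw [circlePt_pow_div hσ]
  exact (Summable.of_norm_bounded ((summable_pow_succ (norm_nonneg _) hx).div_const σ)
    (fun m => norm_logGen_term_le hσ θ m)).hasSum

lemma continuous_logGen_circlePt {x : ℂ} (hx : ‖x‖ < 1) {σ : ℝ} (hσ : 0 < σ) :
    Continuous fun θ => logGen x (circlePt σ θ) := by
  unfold logGen
  simp_rw [circlePt_pow_div hσ]
  refine continuous_tsum (fun m => ?_) ((summable_pow_succ (norm_nonneg _) hx).div_const σ)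
    (fun m θ => norm_logGen_term_le hσ θ m)
  refine continuous_const.mul (Continuous.div continuous_const (by fun_prop) fun θ => ?_)
  have h := re_le_norm_mul_exp_sub_one (ξ := 1)
    (z := (((m : ℂ) + 1) * (σ - θ * Complex.I))) (by simp)
  have hre : ((((m : ℂ) + 1) * (σ - θ * Complex.I))).re = ((m : ℝ) + 1) * σ := by simp
  rw [one_mul, hre] at h
  have : 0 < ((m : ℝ) + 1) * σ := by positivity
  exact norm_pos_iff.1 (this.trans_le h)

lemma exp_neg_pow_eq_one {h k : ℕ} (hk : 0 < k) (m : ℕ) :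
    Complex.exp (-2 * Real.pi * Complex.I * m * h / k) ^ k = 1 := by
  rw [← Complex.exp_nat_mul, Complex.exp_eq_one_iff]
  refine ⟨-(m * h : ℤ), ?_⟩
  have : (k : ℂ) ≠ 0 := by exact_mod_cast hk.ne'
  push_cast
  field_simp

lemma exp_neg_eq_one_iff {h k : ℕ} (hk : 0 < k) (hc : h.Coprime k) (m : ℕ) :
    Complex.exp (-2 * Real.pi * Complex.I * m * h / k) = 1 ↔ k ∣ m := by
  have hprim := (Complex.isPrimitiveRoot_exp_of_coprime h k hk.ne' hc)
  rw [← hprim.pow_eq_one_iff_dvd, ← inv_inj, inv_one, ← Complex.exp_neg, ← Complex.exp_nat_mul]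
  have e : -(-2 * Real.pi * Complex.I * m * h / k : ℂ) = m * (2 * Real.pi * Complex.I * (h / k)) := by
    ring
  rw [e]

/-- Expanding `log (1 - x^k) / (2k)` shows that `w` collects the constant terms of the kernels:
`-1/2` where there is a pole, `1 / (ξ - 1)` elsewhere. -/
lemma hasSum_w {x : ℂ} (hx : ‖x‖ < 1) {h k : ℕ} (hk : 0 < k) (hc : h.Coprime k) :
    HasSum (fun m : ℕ => x ^ (m + 1) / ((m : ℂ) + 1) * if k ∣ m + 1 then -1 / 2 else
      1 / (Complex.exp (-2 * Real.pi * Complex.I * (m + 1 : ℕ) * h / k) - 1)) (w h k x) := by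
  obtain ⟨d, hd, hdist⟩ := exists_dist_rootsOfUnity k hk
  set g : ℕ → ℂ := fun l => if k ∣ l then 0 else
      x ^ l / l * (1 / (Complex.exp (-2 * Real.pi * Complex.I * l * h / k) - 1)) with hg
  have hs : Summable g := by
    refine Summable.of_norm_bounded
      ((summable_geometric_of_lt_one (norm_nonneg x) hx).mul_right (1 / d)) fun l => ?_
    simp only [hg]
    split_ifs with hl
    · rw [norm_zero]; positivity
    · have h1 : d ≤ ‖Complex.exp (-2 * Real.pi * Complex.I * l * h / k) - 1‖ :=
        hdist _ (exp_neg_pow_eq_one hk l) (fun h' => hl ((exp_neg_eq_one_iff hk hc l).1 h'))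
      have hl0 : 1 ≤ l := Nat.one_le_iff_ne_zero.2 (by rintro rfl; simp at hl)
      rw [norm_mul, norm_div, norm_div, norm_one, norm_pow, Complex.norm_natCast]
      gcongr
      exact div_le_self (by positivity) (by exact_mod_cast hl0)
  have h1 : HasSum (fun m : ℕ => g (m + 1)) (∑' l, g l) := by
    have := (hasSum_nat_add_iff' 1).2 hs.hasSum
    simpa [hg] using this
  have h2 := ((hasSum_log_multiples hx hk).mul_left (-1 / 2)).add h1
  have e : w h k x = -1 / 2 * (-Complex.log (1 - x ^ k) / k) + ∑' l, g l := by
    rw [w]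
    congr 1
    ring
  rw [e]
  refine h2.congr_fun fun m => ?_
  simp only [hg]
  split_ifs with hl
  · ring
  · push_cast; ring

/-- The expansion of `logGen` at `e^{2πih/k}`, uniform in a sector. -/
theorem exists_logGen_expansion {h k : ℕ} (hk : 0 < k) (hc : h.Coprime k) {M r : ℝ} (hM : 0 ≤ M)
    (hr0 : 0 ≤ r) (hr : r < 1) : ∃ C : ℝ, ∀ x : ℂ, ‖x‖ ≤ r → ∀ σ φ : ℝ, 0 < σ → |φ| ≤ M * σ →
      ‖logGen x (circlePt σ (2 * Real.pi * h / k + φ)) -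
        (L k x ^ 2 / (σ - φ * Complex.I) + w h k x)‖ ≤ C * ‖(σ - φ * Complex.I : ℂ)‖ := by
  obtain ⟨d, hd, hdist⟩ := exists_dist_rootsOfUnity k hk
  obtain ⟨C1, hC1⟩ := exists_bernoulli_kernel_bound M hM
  obtain ⟨C2, hC2⟩ := exists_kernel_bound M d hM hd
  set C := max C1 C2
  refine ⟨∑' m : ℕ, r ^ (m + 1) * C, fun x hx σ φ hσ hφ => ?_⟩
  have hx1 : ‖x‖ < 1 := hx.trans_lt hr
  set τ : ℂ := σ - φ * Complex.I with hτ
  have hτre : τ.re = σ := by simp [hτ]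
  have hτim : τ.im = -φ := by simp [hτ]
  have hτ0 : τ ≠ 0 := by
    intro h0
    rw [h0] at hτre
    simp at hτre
    linarith
  have h1 := hasSum_logGen_circlePt hx1 hσ (2 * Real.pi * h / k + φ)
  have h2 := ((hasSum_L_sq hx1 k).div_const τ).add (hasSum_w hx1 hk hc)
  have h3 := h1.sub h2
  rw [← h3.tsum_eq, ← tsum_mul_right]
  -- The kernel error is linear in `|z| = (m + 1)|τ|`; the coefficient `1 / (m + 1)` cancels that
  -- factor and leaves a geometric series.
  refine tsum_of_norm_bounded
    (((summable_pow_succ hr0 hr).mul_right C).mul_right ‖τ‖).hasSum fun m => ?_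
  set ξ := Complex.exp (-2 * Real.pi * Complex.I * (m + 1 : ℕ) * h / k) with hξ
  set z : ℂ := ((m : ℂ) + 1) * τ with hz
  have hξ1 : ‖ξ‖ = 1 := by
    have := exp_neg_pow_eq_one (h := h) hk (m + 1)
    exact Complex.norm_eq_one_of_pow_eq_one this hk.ne'
  have hm0 : (0 : ℝ) < (m : ℝ) + 1 := by positivity
  have hzre : z.re = ((m : ℝ) + 1) * σ := by
    rw [hz, ← hτre]; simp
  have hzim : z.im = -(((m : ℝ) + 1) * φ) := by
    rw [hz, Complex.mul_im, hτim]; simp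
  have hzpos : 0 < z.re := by rw [hzre]; positivity
  have hzsec : |z.im| ≤ M * z.re := by
    rw [hzim, hzre, abs_neg, abs_mul, abs_of_pos hm0]
    nlinarith [mul_le_mul_of_nonneg_left hφ hm0.le]
  have hznorm : ‖z‖ = ((m : ℝ) + 1) * ‖τ‖ := by
    rw [hz, norm_mul, norm_natCast_succ]
  have hexp : Complex.exp (((m : ℂ) + 1) * (σ - ((2 * Real.pi * h / k + φ : ℝ) : ℂ) * Complex.I)) =
      ξ * Complex.exp z := by
    rw [hξ, hz, hτ, ← Complex.exp_add]
    congr 1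
    push_cast
    ring
  rw [hexp]
  have hcast : ((m : ℂ) + 1) ≠ 0 := Nat.cast_add_one_ne_zero m
  have key : ∃ B : ℂ, ‖B‖ ≤ C * ‖z‖ ∧
      x ^ (m + 1) / ((m : ℂ) + 1) * (1 / (ξ * Complex.exp z - 1)) -
        ((if k ∣ m + 1 then x ^ (m + 1) / ((m : ℂ) + 1) ^ 2 else 0) / τ +
          x ^ (m + 1) / ((m : ℂ) + 1) * (if k ∣ m + 1 then -1 / 2 else 1 / (ξ - 1))) =
      x ^ (m + 1) / ((m : ℂ) + 1) * B := by
    by_cases hdvd : k ∣ m + 1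
    · have hξe : ξ = 1 := (exp_neg_eq_one_iff hk hc (m + 1)).2 hdvd
      refine ⟨1 / (Complex.exp z - 1) - 1 / z + 1 / 2, (hC1 z hzpos hzsec).trans ?_, ?_⟩
      · gcongr; exact le_max_left _ _
      · rw [if_pos hdvd, if_pos hdvd, hξe, one_mul]
        have : x ^ (m + 1) / ((m : ℂ) + 1) ^ 2 / τ = x ^ (m + 1) / ((m : ℂ) + 1) * (1 / z) := by
          rw [hz]; field_simp
        rw [this]; ring
    · refine ⟨1 / (ξ * Complex.exp z - 1) - 1 / (ξ - 1), (hC2 ξ z hξ1 ?_ hzpos hzsec).trans ?_, ?_⟩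
      · exact hdist _ (exp_neg_pow_eq_one hk (m + 1))
          (fun h' => hdvd ((exp_neg_eq_one_iff hk hc (m + 1)).1 h'))
      · gcongr; exact le_max_right _ _
      · rw [if_neg hdvd, if_neg hdvd]; ring
  obtain ⟨B, hB, hBe⟩ := key
  rw [hBe, norm_mul, norm_div, norm_pow, norm_natCast_succ]
  calc ‖x‖ ^ (m + 1) / ((m : ℝ) + 1) * ‖B‖ ≤ r ^ (m + 1) / ((m : ℝ) + 1) * (C * ‖z‖) := by gcongr
    _ = r ^ (m + 1) * C * ‖τ‖ := by rw [hznorm]; field_simp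

/-! ### The growth of `logGen` near the unit circle -/

lemma exp_mul_I_pow_eq_one_iff (θ : ℝ) (m : ℕ) :
    orderOf (Complex.exp (θ * Complex.I)) ∣ m ↔
      Complex.exp ((m : ℂ) * -(θ * Complex.I)) = 1 := by
  rw [orderOf_dvd_iff_pow_eq_one, ← Complex.exp_nat_mul, mul_neg, Complex.exp_neg, inv_eq_one]

lemma norm_ofReal_div_sub_le_one {σ : ℝ} (hσ : 0 < σ) (φ : ℝ) :
    ‖(σ : ℂ) / (σ - φ * Complex.I)‖ ≤ 1 := by
  rw [norm_div, Complex.norm_real, Real.norm_of_nonneg hσ.le]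
  have h := Complex.re_le_norm ((σ : ℂ) - φ * Complex.I)
  have e : ((σ : ℂ) - φ * Complex.I).re = σ := by simp
  rw [e] at h
  exact div_le_one_of_le₀ h (norm_nonneg _)

lemma sub_mul_I_ne_zero {σ : ℝ} (hσ : 0 < σ) (φ : ℝ) : (σ : ℂ) - φ * Complex.I ≠ 0 := by
  intro h
  have := congrArg Complex.re h
  simp at this
  linarith

/-- If `e^{-i(m+1)θ₀} = 1` the kernel has the pole `1/z` and only a bounded remainder, which the
factor `σ` kills; otherwise the kernel stays bounded. No sector is imposed on `(σ, θ)`: the estimate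
`|σ/τ| ≤ 1` suffices. -/
lemma tendsto_logGen_term {x : ℂ} (hx : ‖x‖ < 1) (θ₀ : ℝ) (m : ℕ) :
    Tendsto (fun p : (ℝ × ℂ) × ℝ =>
      (p.1.1 : ℂ) * (p.1.2 ^ (m + 1) / ((m : ℂ) + 1) *
        (1 / (Complex.exp (((m : ℂ) + 1) * (p.1.1 - p.2 * Complex.I)) - 1))) -
      (p.1.1 : ℂ) / (p.1.1 - (p.2 - θ₀ : ℝ) * Complex.I) *
        (if orderOf (Complex.exp (θ₀ * Complex.I)) ∣ m + 1 then
          x ^ (m + 1) / ((m : ℂ) + 1) ^ 2 else 0))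
      ((𝓝[>] 0 ×ˢ 𝓝 x) ×ˢ 𝓝 θ₀) (𝓝 0) := by
  set l : Filter ((ℝ × ℂ) × ℝ) := (𝓝[>] 0 ×ˢ 𝓝 x) ×ˢ 𝓝 θ₀
  have hσw : Tendsto (fun p : (ℝ × ℂ) × ℝ => p.1.1) l (𝓝[>] 0) := tendsto_fst.comp tendsto_fst
  have hσ : Tendsto (fun p : (ℝ × ℂ) × ℝ => p.1.1) l (𝓝 0) := hσw.mono_right nhdsWithin_le_nhds
  have hy : Tendsto (fun p : (ℝ × ℂ) × ℝ => p.1.2) l (𝓝 x) := tendsto_snd.comp tendsto_fst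
  have hθ : Tendsto (fun p : (ℝ × ℂ) × ℝ => p.2) l (𝓝 θ₀) := tendsto_snd
  have hpos : ∀ᶠ p : (ℝ × ℂ) × ℝ in l, 0 < p.1.1 := hσw.eventually self_mem_nhdsWithin
  have hσc : Tendsto (fun p : (ℝ × ℂ) × ℝ => (p.1.1 : ℂ)) l (𝓝 0) := by
    simpa [Function.comp_def] using (Complex.continuous_ofReal.tendsto 0).comp hσ
  have hθc : Tendsto (fun p : (ℝ × ℂ) × ℝ => (p.2 : ℂ)) l (𝓝 θ₀) :=
    (Complex.continuous_ofReal.tendsto _).comp hθ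
  have hcast : ((m : ℂ) + 1) ≠ 0 := Nat.cast_add_one_ne_zero m
  by_cases hdvd : orderOf (Complex.exp (θ₀ * Complex.I)) ∣ m + 1
  · have hone := (exp_mul_I_pow_eq_one_iff θ₀ (m + 1)).1 hdvd
    simp only [if_pos hdvd]
    have hτ : Tendsto (fun p : (ℝ × ℂ) × ℝ =>
        ((m : ℂ) + 1) * ((p.1.1 : ℂ) - (p.2 - θ₀ : ℝ) * Complex.I)) l (𝓝 0) := by
      have h1 : Tendsto (fun p : (ℝ × ℂ) × ℝ => ((p.2 - θ₀ : ℝ) : ℂ)) l (𝓝 0) := by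
        have := (Complex.continuous_ofReal.tendsto _).comp (hθ.sub_const θ₀)
        simpa [Function.comp_def] using this
      simpa using (hσc.sub (h1.mul_const Complex.I)).const_mul ((m : ℂ) + 1)
    have hsmall : ∀ᶠ p : (ℝ × ℂ) × ℝ in l,
        ‖((m : ℂ) + 1) * ((p.1.1 : ℂ) - (p.2 - θ₀ : ℝ) * Complex.I)‖ < 1 / 2 := by
      have := hτ.norm
      rw [norm_zero] at this
      exact this.eventually_lt_const (by norm_num)
    have hylt : ∀ᶠ p : (ℝ × ℂ) × ℝ in l, ‖p.1.2‖ < 1 := hy.norm.eventually_lt_const hx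
    have hmain : Tendsto (fun p : (ℝ × ℂ) × ℝ => p.1.1 * 2 + ‖p.1.2 ^ (m + 1) - x ^ (m + 1)‖) l
        (𝓝 0) := by
      have h1 := ((hy.pow (m + 1)).sub_const (x ^ (m + 1))).norm
      simpa using (hσ.mul_const 2).add h1
    refine squeeze_zero_norm' ?_ hmain
    filter_upwards [hpos, hsmall, hylt] with p hp hs hy1
    have hexp : Complex.exp (((m : ℂ) + 1) * (p.1.1 - p.2 * Complex.I)) =
        Complex.exp (((m : ℂ) + 1) * ((p.1.1 : ℂ) - (p.2 - θ₀ : ℝ) * Complex.I)) := by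
      have e : ((m : ℂ) + 1) * (p.1.1 - p.2 * Complex.I) =
          ((m : ℂ) + 1) * ((p.1.1 : ℂ) - (p.2 - θ₀ : ℝ) * Complex.I) +
            (m + 1 : ℕ) * -(θ₀ * Complex.I) := by
        push_cast
        ring
      rw [e, Complex.exp_add, hone, mul_one]
    rw [hexp]
    have hτ0 := sub_mul_I_ne_zero hp (p.2 - θ₀)
    have hle1 := norm_ofReal_div_sub_le_one hp (p.2 - θ₀)
    set τ : ℂ := (p.1.1 : ℂ) - (p.2 - θ₀ : ℝ) * Complex.I
    have hz0 : ((m : ℂ) + 1) * τ ≠ 0 := mul_ne_zero hcast hτ0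
    have hB := norm_bernoulli_kernel_le hz0 hs.le
    set z := ((m : ℂ) + 1) * τ with hz
    have e : (p.1.1 : ℂ) * (p.1.2 ^ (m + 1) / ((m : ℂ) + 1) * (1 / (Complex.exp z - 1))) -
        (p.1.1 : ℂ) / τ * (x ^ (m + 1) / ((m : ℂ) + 1) ^ 2) =
        (p.1.1 : ℂ) * (p.1.2 ^ (m + 1) / ((m : ℂ) + 1) *
          ((1 / (Complex.exp z - 1) - 1 / z + 1 / 2) - 1 / 2)) +
        (p.1.1 : ℂ) / τ * ((p.1.2 ^ (m + 1) - x ^ (m + 1)) / ((m : ℂ) + 1) ^ 2) := by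
      have : 1 / z = 1 / ((m : ℂ) + 1) * (1 / τ) := by rw [hz]; field_simp
      rw [this]
      generalize (m : ℂ) + 1 = a
      ring
    rw [e]
    refine (norm_add_le _ _).trans (add_le_add ?_ ?_)
    · rw [norm_mul, Complex.norm_real, Real.norm_of_nonneg hp.le]
      refine mul_le_mul_of_nonneg_left ?_ hp.le
      have h1 : ‖p.1.2 ^ (m + 1) / ((m : ℂ) + 1)‖ ≤ 1 := by
        rw [norm_div, norm_pow, norm_natCast_succ]
        refine div_le_one_of_le₀ ((pow_le_one₀ (norm_nonneg _) hy1.le).trans ?_) (by positivity)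
        simp
      have h2 : ‖(1 / (Complex.exp z - 1) - 1 / z + 1 / 2) - 1 / 2‖ ≤ 2 := by
        refine (norm_sub_le _ _).trans ?_
        have : ‖(1 / 2 : ℂ)‖ = 1 / 2 := by simp
        linarith
      rw [norm_mul]
      calc _ ≤ 1 * (2 : ℝ) := by gcongr
        _ = 2 := by ring
    · rw [norm_mul]
      refine (mul_le_of_le_one_left (norm_nonneg _) hle1).trans ?_
      rw [norm_div, norm_pow, norm_natCast_succ]
      refine div_le_self (norm_nonneg _) ?_
      exact one_le_pow₀ (by simp)
  · simp only [if_neg hdvd, mul_zero, sub_zero]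
    have hne : Complex.exp (((m : ℂ) + 1) * -(θ₀ * Complex.I)) - 1 ≠ 0 := by
      intro h
      refine hdvd ((exp_mul_I_pow_eq_one_iff θ₀ (m + 1)).2 ?_)
      push_cast
      exact sub_eq_zero.1 h
    have h1 : Tendsto (fun p : (ℝ × ℂ) × ℝ =>
        Complex.exp (((m : ℂ) + 1) * ((p.1.1 : ℂ) - p.2 * Complex.I)) - 1) l
        (𝓝 (Complex.exp (((m : ℂ) + 1) * -(θ₀ * Complex.I)) - 1)) := by
      have h2 := (hσc.sub (hθc.mul_const Complex.I)).const_mul ((m : ℂ) + 1)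
      rw [zero_sub] at h2
      exact ((Complex.continuous_exp.tendsto _).comp h2).sub_const 1
    have h3 := hσc.mul (((hy.pow (m + 1)).div_const ((m : ℂ) + 1)).mul
      ((tendsto_const_nhds (x := (1 : ℂ))).div h1 hne))
    rw [zero_mul] at h3
    exact h3

/-- Near a root of unity `e^{iθ₀}` of order `j`, `logGen` grows like `L_j(x)² / τ`; near the other
points of the unit circle (`j = 0`) it grows more slowly. -/
theorem tendsto_logGen {x : ℂ} (hx : ‖x‖ < 1) (θ₀ : ℝ) :
    Tendsto (fun p : (ℝ × ℂ) × ℝ => (p.1.1 : ℂ) * logGen p.1.2 (circlePt p.1.1 p.2) -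
      (p.1.1 : ℂ) / (p.1.1 - (p.2 - θ₀ : ℝ) * Complex.I) *
        L (orderOf (Complex.exp (θ₀ * Complex.I))) x ^ 2)
      ((𝓝[>] 0 ×ˢ 𝓝 x) ×ˢ 𝓝 θ₀) (𝓝 0) := by
  obtain ⟨r, hr1, hr2⟩ := exists_between hx
  have hr0 : 0 ≤ r := (norm_nonneg x).trans hr1.le
  set l : Filter ((ℝ × ℂ) × ℝ) := (𝓝[>] 0 ×ˢ 𝓝 x) ×ˢ 𝓝 θ₀
  have hσw : Tendsto (fun p : (ℝ × ℂ) × ℝ => p.1.1) l (𝓝[>] 0) := tendsto_fst.comp tendsto_fst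
  have hy : Tendsto (fun p : (ℝ × ℂ) × ℝ => p.1.2) l (𝓝 x) := tendsto_snd.comp tendsto_fst
  have hpos : ∀ᶠ p : (ℝ × ℂ) × ℝ in l, 0 < p.1.1 := hσw.eventually self_mem_nhdsWithin
  have hylt : ∀ᶠ p : (ℝ × ℂ) × ℝ in l, ‖p.1.2‖ < r := hy.norm.eventually_lt_const hr1
  have h := tendsto_tsum_of_dominated_convergence (bound := fun m : ℕ => r ^ (m + 1) * 2)
    ((summable_pow_succ hr0 hr2).mul_right 2) (fun m => tendsto_logGen_term hx θ₀ m) (by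
      filter_upwards [hpos, hylt] with p hp hy1 m
      refine (norm_sub_le _ _).trans ?_
      rw [mul_two]
      refine add_le_add ?_ ?_
      · rw [norm_mul, Complex.norm_real, Real.norm_of_nonneg hp.le]
        calc _ ≤ p.1.1 * (‖p.1.2‖ ^ (m + 1) / p.1.1) :=
              mul_le_mul_of_nonneg_left (norm_logGen_term_le hp p.2 m) hp.le
          _ = ‖p.1.2‖ ^ (m + 1) := by field_simp
          _ ≤ _ := by gcongr
      · rw [norm_mul]
        refine (mul_le_of_le_one_left (norm_nonneg _) (norm_ofReal_div_sub_le_one hp _)).trans ?_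
        split_ifs
        · rw [norm_div, norm_pow, norm_pow, norm_natCast_succ]
          refine (div_le_self (by positivity) (one_le_pow₀ (by simp))).trans ?_
          gcongr
        · rw [norm_zero]; positivity)
  rw [tsum_zero] at h
  refine h.congr' ?_
  filter_upwards [hpos, hylt] with p hp hy1
  have h1 := (hasSum_logGen_circlePt (hy1.trans hr2) hp p.2).mul_left (p.1.1 : ℂ)
  have h2 := (hasSum_L_sq hx (orderOf (Complex.exp (θ₀ * Complex.I)))).mul_left
    ((p.1.1 : ℂ) / (p.1.1 - (p.2 - θ₀ : ℝ) * Complex.I))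
  exact (h1.sub h2).tsum_eq

/-- The defect is the square `(φ Re a + σ Im a)² / (σ² + φ²)`. This is why `f_j = Re L_j`, and not
`|L_j|`, measures the size of a singularity. -/
lemma re_div_mul_sq_le {σ : ℝ} (hσ : 0 < σ) (φ : ℝ) (a : ℂ) :
    ((σ : ℂ) / (σ - φ * Complex.I) * a ^ 2).re ≤ a.re ^ 2 := by
  have hpos : 0 < σ ^ 2 + φ ^ 2 := by positivity
  have e : (σ : ℂ) / (σ - φ * Complex.I) =
      ((σ ^ 2 / (σ ^ 2 + φ ^ 2) : ℝ) : ℂ) + ((σ * φ / (σ ^ 2 + φ ^ 2) : ℝ) : ℂ) * Complex.I := by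
    rw [div_eq_iff (sub_mul_I_ne_zero hσ φ)]
    have : ((σ : ℂ) ^ 2 + (φ : ℂ) ^ 2) ≠ 0 := by exact_mod_cast hpos.ne'
    push_cast
    field_simp
    linear_combination (σ : ℂ) * φ ^ 2 * Complex.I_sq
  rw [e]
  have e2 : ((((σ ^ 2 / (σ ^ 2 + φ ^ 2) : ℝ) : ℂ) +
      ((σ * φ / (σ ^ 2 + φ ^ 2) : ℝ) : ℂ) * Complex.I) * a ^ 2).re =
      (σ ^ 2 * (a.re ^ 2 - a.im ^ 2) - σ * φ * (2 * a.re * a.im)) / (σ ^ 2 + φ ^ 2) := by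
    rw [pow_two a]
    simp only [Complex.mul_re, Complex.add_re, Complex.add_im, Complex.ofReal_re, Complex.ofReal_im,
      Complex.I_re, Complex.I_im, Complex.mul_im]
    ring
  rw [e2, div_le_iff₀ hpos]
  nlinarith [sq_nonneg (φ * a.re + σ * a.im)]

/-- The `k`-th roots of unity are `2π/k` apart, so the centre is the only one on an arc of
half-width `π/k`. -/
lemma orderOf_exp_eq_imp {h k : ℕ} (hk : 0 < k) {φ : ℝ} (hφ : |φ| ≤ Real.pi / k)
    (ho : orderOf (Complex.exp (((2 * Real.pi * h / k + φ : ℝ) : ℂ) * Complex.I)) = k) :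
    φ = 0 ∧ h.Coprime k := by
  have hk' : (k : ℂ) ≠ 0 := by exact_mod_cast hk.ne'
  have hkr : (0 : ℝ) < k := by exact_mod_cast hk
  have h1 := pow_orderOf_eq_one (Complex.exp (((2 * Real.pi * h / k + φ : ℝ) : ℂ) * Complex.I))
  rw [ho, ← Complex.exp_nat_mul, Complex.exp_eq_one_iff] at h1
  obtain ⟨n, hn⟩ := h1
  have h2 : (k : ℝ) * φ = 2 * Real.pi * (n - h) := by
    have : ((k * φ : ℝ) : ℂ) * Complex.I = ((2 * Real.pi * (n - h) : ℝ) : ℂ) * Complex.I := by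
      have e : (k : ℂ) * (((2 * Real.pi * h / k + φ : ℝ) : ℂ) * Complex.I) =
        2 * Real.pi * h * Complex.I + k * φ * Complex.I := by
          push_cast; field_simp
      rw [e] at hn
      push_cast
      linear_combination hn
    exact_mod_cast mul_right_cancel₀ Complex.I_ne_zero this
  have h3 : |(k : ℝ) * φ| ≤ Real.pi := by
    rw [abs_mul, abs_of_pos hkr]
    calc _ ≤ (k : ℝ) * (Real.pi / k) := by gcongr
      _ = _ := by field_simp
  have hnh : n - h = 0 := by
    rw [h2, abs_mul, abs_of_pos (by positivity)] at h3
    have h4 : |((n - h : ℤ) : ℝ)| < 1 := by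
      push_cast
      nlinarith [Real.pi_pos]
    rw [← Int.cast_abs] at h4
    exact Int.abs_lt_one_iff.1 (by exact_mod_cast h4)
  have hφ0 : φ = 0 := by
    have : (n : ℝ) - h = 0 := by exact_mod_cast hnh
    rw [this, mul_zero] at h2
    exact (mul_eq_zero.1 h2).resolve_left hkr.ne'
  refine ⟨hφ0, ?_⟩
  rw [← (Complex.isPrimitiveRoot_exp k hk.ne').pow_iff_coprime hk h, ← Complex.exp_nat_mul]
  have h5 := IsPrimitiveRoot.orderOf
    (Complex.exp (((2 * Real.pi * h / k + φ : ℝ) : ℂ) * Complex.I))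
  rw [ho, hφ0] at h5
  have e : ((2 * Real.pi * h / k + 0 : ℝ) : ℂ) * Complex.I =
      (h : ℂ) * (2 * Real.pi * Complex.I / k) := by
    push_cast
    ring
  rwa [e] at h5

/-- Away from the dominant singularities `logGen` is smaller by a positive proportion. -/
theorem exists_minor_arc_bound {x : ℂ} (hx : ‖x‖ < 1) {k : ℕ} (hk : 0 < k)
    (hmax : ∀ j, 0 < j → j ≠ k → f j x < f k x) (hpos : 0 < f k x) (h : ℕ) {M : ℝ} (hM : 0 < M)
    (hML : ‖L k x‖ ^ 2 / M < f k x ^ 2) :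
    ∃ c < f k x ^ 2, ∀ᶠ p : ℝ × ℂ in 𝓝[>] 0 ×ˢ 𝓝 x,
      ∀ φ ∈ Set.Icc (-(Real.pi / k)) (Real.pi / k), (h.Coprime k → M * p.1 ≤ |φ|) →
        p.1 * (logGen p.2 (circlePt p.1 (2 * Real.pi * h / k + φ))).re ≤ c := by
  have hsigma : ∀ᶠ p : ℝ × ℂ in 𝓝[>] 0 ×ˢ 𝓝 x, 0 < p.1 :=
    tendsto_fst.eventually self_mem_nhdsWithin
  -- The joint limit in `tendsto_logGen` gives a bound near each angle; compactness leaves finitely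
  -- many values of `c`, and their maximum serves.
  refine (isCompact_Icc (a := -(Real.pi / k)) (b := Real.pi / k)).induction_on
    (p := fun s => ∃ c < f k x ^ 2, ∀ᶠ p : ℝ × ℂ in 𝓝[>] 0 ×ˢ 𝓝 x,
      ∀ φ ∈ s, (h.Coprime k → M * p.1 ≤ |φ|) →
        p.1 * (logGen p.2 (circlePt p.1 (2 * Real.pi * h / k + φ))).re ≤ c) ?_ ?_ ?_ ?_
  · exact ⟨0, by positivity, by simp⟩
  · rintro s t hst ⟨c, hc, hev⟩
    exact ⟨c, hc, hev.mono fun p hp φ hφ => hp φ (hst hφ)⟩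
  · rintro s t ⟨c, hc, hev⟩ ⟨c', hc', hev'⟩
    refine ⟨max c c', max_lt hc hc', ?_⟩
    filter_upwards [hev, hev'] with p hp hp' φ hφ hcop
    rcases hφ with hφ | hφ
    · exact (hp φ hφ hcop).trans (le_max_left _ _)
    · exact (hp' φ hφ hcop).trans (le_max_right _ _)
  · intro φ₀ hφ₀
    set θ₀ : ℝ := 2 * Real.pi * h / k + φ₀ with hθ₀
    set j := orderOf (Complex.exp (θ₀ * Complex.I)) with hj
    have hbound : ∃ b < f k x ^ 2, ∀ σ φ : ℝ, 0 < σ → (h.Coprime k → M * σ ≤ |φ|) →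
        ((σ : ℂ) / (σ - (φ - φ₀ : ℝ) * Complex.I) * L j x ^ 2).re ≤ b := by
      -- At a point of order `k`, which can only be the centre of a coprime arc, the excluded window
      -- forces `|σ/τ| ≤ 1/M`. At any other order, the bound `f_j² < f_k²` holds in every direction.
      by_cases hjk : j = k
      · obtain ⟨h0, hcop⟩ := orderOf_exp_eq_imp hk (abs_le.2 hφ₀) hjk
        refine ⟨_, hML, fun σ φ hσ hφ => ?_⟩
        rw [hjk, h0, sub_zero]
        refine (Complex.re_le_norm _).trans ?_
        rw [norm_mul, norm_div, norm_pow, Complex.norm_real, Real.norm_of_nonneg hσ.le, mul_comm,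
          div_eq_mul_inv _ M]
        refine mul_le_mul_of_nonneg_left ?_ (by positivity)
        have h1 := Complex.abs_im_le_norm ((σ : ℂ) - φ * Complex.I)
        have e : ((σ : ℂ) - φ * Complex.I).im = -φ := by simp
        rw [e, abs_neg] at h1
        have h2 := (hφ hcop).trans h1
        rw [div_le_iff₀ ((by positivity : 0 < M * σ).trans_le h2)]
        calc σ = M⁻¹ * (M * σ) := by field_simp
          _ ≤ _ := by gcongr
      · refine ⟨f j x ^ 2, ?_, fun σ φ hσ _ => re_div_mul_sq_le hσ _ _⟩
        rcases Nat.eq_zero_or_pos j with h0 | h0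
        · have : f j x = 0 := by rw [h0]; simp [f, L]
          rw [this, zero_pow two_ne_zero]; positivity
        · exact pow_lt_pow_left₀ (hmax j h0 hjk) (f_nonneg _ _) (by norm_num)
    obtain ⟨b, hb, hbound⟩ := hbound
    obtain ⟨c, hbc, hc⟩ := exists_between hb
    have ht := tendsto_logGen hx θ₀
    have hev : ∀ᶠ p : (ℝ × ℂ) × ℝ in (𝓝[>] 0 ×ˢ 𝓝 x) ×ˢ 𝓝 θ₀,
        ‖(p.1.1 : ℂ) * logGen p.1.2 (circlePt p.1.1 p.2) -
          (p.1.1 : ℂ) / (p.1.1 - (p.2 - θ₀ : ℝ) * Complex.I) * L j x ^ 2‖ < c - b := by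
      have := ht.norm
      rw [norm_zero] at this
      exact this.eventually_lt_const (by linarith)
    obtain ⟨P, hP, Q, hQ, hPQ⟩ := eventually_prod_iff.1 hev
    have hQ' : ∀ᶠ φ in 𝓝 φ₀, Q (2 * Real.pi * h / k + φ) := by
      have : Tendsto (fun φ : ℝ => 2 * Real.pi * h / k + φ) (𝓝 φ₀) (𝓝 θ₀) :=
        tendsto_const_nhds.add tendsto_id
      exact this.eventually hQ
    refine ⟨{φ | Q (2 * Real.pi * h / k + φ)}, mem_nhdsWithin_of_mem_nhds hQ', c, hc, ?_⟩
    filter_upwards [hP, hsigma] with p hp hσ φ hφ hcop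
    have h1 := (hPQ hp hφ).le
    have h2 := hbound p.1 φ hσ hcop
    have e : (2 * Real.pi * h / k + φ - θ₀ : ℝ) = φ - φ₀ := by rw [hθ₀]; ring
    simp only at h1
    rw [e] at h1
    have h3 := (Complex.re_le_norm _).trans h1
    rw [Complex.sub_re, Complex.re_ofReal_mul] at h3
    linarith

/-! ### The saddle point -/

/-- On the cut `(-∞, 0]` the principal root has real part zero. Hence `L k` is continuous wherever
`f k` is positive. -/
lemma mem_slitPlane_of_f_pos {k : ℕ} {x : ℂ} (h : 0 < f k x) :
    Li2 (x ^ k) ∈ Complex.slitPlane := by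
  rw [Complex.mem_slitPlane_iff]
  by_contra hc
  push Not at hc
  have h1 := re_csqrt_sq (Li2 (x ^ k))
  have h2 : ‖Li2 (x ^ k)‖ = -(Li2 (x ^ k)).re := by
    have : Li2 (x ^ k) = ((Li2 (x ^ k)).re : ℂ) := Complex.ext (by simp) (by simp [hc.2])
    rw [this, Complex.norm_real, Real.norm_of_nonpos hc.1, Complex.ofReal_re]
  rw [h2] at h1
  have h3 : f k x ^ 2 = 0 := by rw [f_sq, h1]; simp
  exact h.ne' (pow_eq_zero_iff two_ne_zero |>.1 h3)

lemma continuousAt_csqrt {z : ℂ} (hz : z ∈ Complex.slitPlane) : ContinuousAt csqrt z :=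
  continuousAt_id.cpow continuousAt_const hz

lemma continuousAt_L {k : ℕ} (hk : 0 < k) {x : ℂ} (hx : ‖x‖ < 1) (h : 0 < f k x) :
    ContinuousAt (L k) x := by
  have hxk : ‖x ^ k‖ < 1 := by rw [norm_pow]; exact pow_lt_one₀ (norm_nonneg _) hx hk.ne'
  have h1 : ContinuousAt (fun y : ℂ => Li2 (y ^ k)) x :=
    ContinuousAt.comp (g := Li2) (hasDerivAt_Li2 hxk).continuousAt (by fun_prop)
  exact (ContinuousAt.comp (g := csqrt) (f := fun y : ℂ => Li2 (y ^ k))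
    (continuousAt_csqrt (mem_slitPlane_of_f_pos h)) h1).div_const _

lemma exists_norm_w_le {h k : ℕ} (hk : 0 < k) (hc : h.Coprime k) {r : ℝ} (hr0 : 0 ≤ r)
    (hr : r < 1) : ∃ C : ℝ, ∀ x : ℂ, ‖x‖ ≤ r → ‖w h k x‖ ≤ C := by
  obtain ⟨d, hd, hdist⟩ := exists_dist_rootsOfUnity k hk
  refine ⟨∑' m : ℕ, r ^ (m + 1) * (1 / 2 + 1 / d), fun x hx => ?_⟩
  rw [← (hasSum_w (hx.trans_lt hr) hk hc).tsum_eq]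
  refine tsum_of_norm_bounded ((summable_pow_succ hr0 hr).mul_right _).hasSum fun m => ?_
  rw [norm_mul, norm_div, norm_pow, norm_natCast_succ]
  refine mul_le_mul ?_ ?_ (norm_nonneg _) (by positivity)
  · refine (div_le_self (by positivity) (by simp)).trans ?_
    gcongr
  · split_ifs with hl
    · have : ‖(-1 / 2 : ℂ)‖ = 1 / 2 := by simp
      rw [this]
      have : 0 < 1 / d := by positivity
      linarith
    · have h1 := hdist _ (exp_neg_pow_eq_one (h := h) hk (m + 1))
        (fun h' => hl ((exp_neg_eq_one_iff hk hc (m + 1)).1 h'))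
      rw [norm_div, norm_one]
      have : 1 / ‖Complex.exp (-2 * Real.pi * Complex.I * (m + 1 : ℕ) * h / k) - 1‖ ≤ 1 / d := by
        gcongr
      linarith

/-- `n^{1/4}`. -/
def fourthRoot (n : ℕ) : ℝ := (n : ℝ) ^ (1 / 4 : ℝ)

lemma one_le_fourthRoot {n : ℕ} (hn : 1 ≤ n) : 1 ≤ fourthRoot n :=
  Real.one_le_rpow (by exact_mod_cast hn) (by norm_num)

lemma fourthRoot_pow (n : ℕ) : fourthRoot n ^ 4 = n := by
  rw [fourthRoot, ← Real.rpow_natCast, ← Real.rpow_mul (Nat.cast_nonneg n)]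
  norm_num

lemma fourthRoot_nonneg (n : ℕ) : 0 ≤ fourthRoot n := Real.rpow_nonneg (Nat.cast_nonneg n) _

lemma fourthRoot_sq (n : ℕ) : fourthRoot n ^ 2 = Real.sqrt n := by
  rw [eq_comm, Real.sqrt_eq_iff_mul_self_eq (Nat.cast_nonneg n) (by positivity), ← fourthRoot_pow]
  ring

lemma rpow_neg_three_quarters (n : ℕ) :
    (n : ℝ) ^ (-(3 / 4) : ℝ) = (fourthRoot n ^ 3)⁻¹ := by
  have h0 : (0 : ℝ) ≤ n := Nat.cast_nonneg n
  rw [fourthRoot, ← Real.rpow_natCast, ← Real.rpow_mul h0, Real.rpow_neg h0]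
  norm_num

lemma tendsto_fourthRoot : Tendsto fourthRoot atTop atTop :=
  (tendsto_rpow_atTop (by norm_num)).comp tendsto_natCast_atTop_atTop

/-- The exponent of the integrand near the saddle point, in the variable `t` given by
`τ = (L + i t / b) / b²`, relative to its value at the saddle point. -/
def saddleExponent (h k : ℕ) (b : ℝ) (y : ℂ) (t : ℝ) : ℂ :=
  logGen y (circlePt (f k y / b ^ 2) (2 * Real.pi * h / k + (-1 / b ^ 3 * t + -(L k y).im / b ^ 2))) +
    b ^ 2 * (L k y + t / b * Complex.I) - w h k y - 2 * b ^ 2 * L k y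

lemma continuous_saddleExponent (h k : ℕ) {b : ℝ} (hb : 0 < b) {y : ℂ} (hy : ‖y‖ < 1)
    (hf : 0 < f k y) : Continuous (saddleExponent h k b y) := by
  unfold saddleExponent
  have h1 := (continuous_logGen_circlePt hy (σ := f k y / b ^ 2) (by positivity)).comp
    (f := fun t : ℝ => 2 * Real.pi * h / k + (-1 / b ^ 3 * t + -(L k y).im / b ^ 2)) (by fun_prop)
  simp only [Function.comp_def] at h1
  fun_prop

/-- With `u = L + it/b`, the exponent is exact: `b² (L²/u + u - 2L) = b² (u - L)² / u = -t² / u`.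
The only error is that of `exists_logGen_expansion` at `τ = u / b²`. -/
lemma exists_saddleExponent_bound {h k : ℕ} (hk : 0 < k) (hc : h.Coprime k) {M r : ℝ} (hM : 0 ≤ M)
    (hr0 : 0 ≤ r) (hr : r < 1) : ∃ C : ℝ, 0 ≤ C ∧ ∀ y : ℂ, ‖y‖ ≤ r → 0 < f k y → ∀ b t : ℝ, 0 < b →
      |(L k y).im + t / b| ≤ M * f k y →
      ‖saddleExponent h k b y t + t ^ 2 / (L k y + t / b * Complex.I)‖ ≤
        C * ‖L k y + t / b * Complex.I‖ / b ^ 2 := by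
  obtain ⟨C, hC⟩ := exists_logGen_expansion hk hc hM hr0 hr
  refine ⟨max C 0, le_max_right _ _, fun y hy hf b t hb ht => ?_⟩
  set Λ := L k y with hΛ
  set u : ℂ := Λ + t / b * Complex.I with hu
  set φ : ℝ := -1 / b ^ 3 * t + -Λ.im / b ^ 2 with hφ
  have hbc : (b : ℂ) ≠ 0 := by exact_mod_cast hb.ne'
  have hure : u.re = f k y := by
    simp [hu, f, hΛ, Complex.div_im]
  have hu0 : u ≠ 0 := by
    intro h0
    rw [h0] at hure
    simp at hure
    linarith
  have hφe : φ = -(Λ.im + t / b) / b ^ 2 := by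
    rw [hφ]; field_simp; ring
  have hτ : ((f k y / b ^ 2 : ℝ) : ℂ) - φ * Complex.I = u / b ^ 2 := by
    rw [hφe, hu]
    have : Λ = (f k y : ℂ) + Λ.im * Complex.I := by
      rw [f, ← hΛ, Complex.re_add_im]
    nth_rewrite 2 [this]
    push_cast
    field_simp
    ring
  have h1 := hC y hy (f k y / b ^ 2) φ (by positivity) (by
    rw [hφe, abs_div, abs_neg, abs_of_pos (by positivity : 0 < b ^ 2), mul_div_assoc']
    gcongr)
  rw [hτ] at h1
  have e : saddleExponent h k b y t + t ^ 2 / u =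
      logGen y (circlePt (f k y / b ^ 2) (2 * Real.pi * h / k + φ)) -
        (Λ ^ 2 / (u / b ^ 2) + w h k y) := by
    have e1 : Λ ^ 2 / (u / b ^ 2) = b ^ 2 * (2 * Λ - u) - t ^ 2 / u := by
      have ht2 : (t : ℂ) ^ 2 = -(b ^ 2 * (u - Λ) ^ 2) := by
        have : u - Λ = t / b * Complex.I := by rw [hu]; ring
        rw [this, mul_pow, Complex.I_sq]
        field_simp
      rw [ht2]
      field_simp
      ring
    rw [e1, saddleExponent]
    ring
  rw [e]
  refine h1.trans ?_
  rw [norm_div, norm_pow, Complex.norm_real, Real.norm_of_nonneg hb.le, mul_div_assoc]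
  gcongr
  exact le_max_left _ _

lemma integral_exp_neg_sq_div {a : ℂ} (ha : 0 < a.re) :
    ∫ t : ℝ, Complex.exp (-((t : ℂ) ^ 2 / a)) = (Real.sqrt Real.pi : ℂ) * csqrt a := by
  have h1 : 0 < (1 / a).re := by
    rw [one_div, Complex.inv_re]
    exact div_pos ha (Complex.normSq_pos.2 (by rintro rfl; simp at ha))
  have h2 := integral_gaussian_complex h1
  have e : ∀ t : ℝ, Complex.exp (-((t : ℂ) ^ 2 / a)) = Complex.exp (-(1 / a) * (t : ℂ) ^ 2) := by
    intro t; congr 1; ring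
  simp_rw [e]
  have ha0 : a ≠ 0 := by rintro rfl; simp at ha
  have hpi : (Real.pi : ℂ) ≠ 0 := by exact_mod_cast Real.pi_ne_zero
  have hsq : (Real.sqrt Real.pi : ℂ) = Complex.exp (Real.log Real.pi * (1 / 2)) := by
    rw [Real.sqrt_eq_rpow, Real.rpow_def_of_pos Real.pi_pos]
    push_cast
    rfl
  rw [h2, div_div_eq_mul_div, div_one, csqrt, Complex.cpow_def_of_ne_zero (mul_ne_zero hpi ha0),
    Complex.cpow_def_of_ne_zero ha0, Complex.log_ofReal_mul Real.pi_pos ha0, add_mul,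
    Complex.exp_add, hsq]

lemma tendsto_f {k : ℕ} (hk : 0 < k) {x : ℂ} (hx : ‖x‖ < 1) (hpos : 0 < f k x) :
    Tendsto (f k) (𝓝 x) (𝓝 (f k x)) :=
  (Complex.continuous_re.tendsto _).comp (continuousAt_L hk hx hpos)

/-- The range of the variable `t` in which `|Im τ| ≤ M Re τ`. -/
def window (k : ℕ) (M b : ℝ) (y : ℂ) : Set ℝ :=
  Set.Ioc (b * (-(M * f k y) - (L k y).im)) (b * (M * f k y - (L k y).im))

lemma abs_le_of_mem_window {k : ℕ} {M b : ℝ} (hb : 0 < b) {y : ℂ} {t : ℝ}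
    (ht : t ∈ window k M b y) : |(L k y).im + t / b| ≤ M * f k y := by
  obtain ⟨h1, h2⟩ := ht
  rw [abs_le]
  constructor
  · have : -(M * f k y) - (L k y).im ≤ t / b := by rw [le_div_iff₀ hb]; linarith
    linarith
  · have : t / b ≤ M * f k y - (L k y).im := by rw [div_le_iff₀ hb]; linarith
    linarith

/-- Supplies the Gaussian majorant for the window integrals. -/
lemma re_sq_div_ge {u : ℂ} {M : ℝ} (hM : 0 ≤ M) (hu : 0 < u.re) (h : |u.im| ≤ M * u.re) (t : ℝ) :
    t ^ 2 / ((1 + M) ^ 2 * u.re) ≤ ((t : ℂ) ^ 2 / u).re := by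
  have h1 := norm_le_of_sector hu h
  have hn : 0 < ‖u‖ := norm_pos_iff.2 (by rintro rfl; simp at hu)
  have e : ((t : ℂ) ^ 2 / u).re = t ^ 2 * (u.re / ‖u‖ ^ 2) := by
    rw [div_eq_mul_inv, ← Complex.ofReal_pow, Complex.re_ofReal_mul, Complex.inv_re,
      Complex.normSq_eq_norm_sq]
  rw [e, div_eq_mul_inv]
  refine mul_le_mul_of_nonneg_left ?_ (sq_nonneg t)
  rw [inv_eq_one_div, div_le_div_iff₀ (by positivity) (by positivity), one_mul]
  have : ‖u‖ ^ 2 ≤ ((1 + M) * u.re) ^ 2 := by gcongr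
  nlinarith

/-- The contribution of the saddle point. -/
theorem tendsto_integral_window {h k : ℕ} (hk : 0 < k) (hc : h.Coprime k) {x : ℂ} (hx : ‖x‖ < 1)
    (hpos : 0 < f k x) {M : ℝ} (hM : |(L k x).im| < M * f k x) :
    Tendsto (fun p : ℕ × ℂ => ∫ t : ℝ, (window k M (fourthRoot p.1) p.2).indicator
        (fun t => Complex.exp (saddleExponent h k (fourthRoot p.1) p.2 t)) t)
      (atTop ×ˢ 𝓝 x) (𝓝 ((Real.sqrt Real.pi : ℂ) * csqrt (L k x))) := by
  obtain ⟨r, hr1, hr2⟩ := exists_between hx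
  have hr0 : 0 ≤ r := (norm_nonneg x).trans hr1.le
  have hM0 : 0 ≤ M := by
    by_contra hneg
    push Not at hneg
    have := (abs_nonneg _).trans_lt hM
    nlinarith
  obtain ⟨C, hC0, hC⟩ := exists_saddleExponent_bound hk hc hM0 hr0 hr2
  set l : Filter (ℕ × ℂ) := atTop ×ˢ 𝓝 x
  have hb : Tendsto (fun p : ℕ × ℂ => fourthRoot p.1) l atTop := tendsto_fourthRoot.comp tendsto_fst
  have hy : Tendsto (fun p : ℕ × ℂ => p.2) l (𝓝 x) := tendsto_snd
  have hL : Tendsto (fun p : ℕ × ℂ => L k p.2) l (𝓝 (L k x)) :=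
    (continuousAt_L hk hx hpos).tendsto.comp hy
  have hf : Tendsto (fun p : ℕ × ℂ => f k p.2) l (𝓝 (f k x)) := (tendsto_f hk hx hpos).comp hy
  have hLim : Tendsto (fun p : ℕ × ℂ => (L k p.2).im) l (𝓝 (L k x).im) :=
    (Complex.continuous_im.tendsto _).comp hL
  have hylt : ∀ᶠ p : ℕ × ℂ in l, ‖p.2‖ < r := hy.norm.eventually_lt_const hr1
  have hfpos : ∀ᶠ p : ℕ × ℂ in l, 0 < f k p.2 := hf.eventually_const_lt hpos
  have hfle : ∀ᶠ p : ℕ × ℂ in l, f k p.2 < 2 * f k x := hf.eventually_lt_const (by linarith)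
  have hb1 : ∀ᶠ p : ℕ × ℂ in l, 1 ≤ fourthRoot p.1 := hb.eventually_ge_atTop 1
  have hnormu : ∀ p : ℕ × ℂ, 0 < f k p.2 → ∀ t : ℝ, 0 < fourthRoot p.1 →
      |(L k p.2).im + t / fourthRoot p.1| ≤ M * f k p.2 →
      (L k p.2 + t / fourthRoot p.1 * Complex.I).re = f k p.2 ∧
      |(L k p.2 + t / fourthRoot p.1 * Complex.I).im| ≤
        M * (L k p.2 + t / fourthRoot p.1 * Complex.I).re := by
    intro p hp t hbp ht
    have hre : (L k p.2 + t / fourthRoot p.1 * Complex.I).re = f k p.2 := by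
      rw [← Complex.ofReal_div]; simp [f]
    have him : (L k p.2 + t / fourthRoot p.1 * Complex.I).im =
        (L k p.2).im + t / fourthRoot p.1 := by
      rw [← Complex.ofReal_div]; simp
    rw [hre, him]
    exact ⟨rfl, ht⟩
  rw [← integral_exp_neg_sq_div hpos]
  set c : ℝ := 1 / ((1 + M) ^ 2 * (2 * f k x)) with hcdef
  have hc0 : 0 < c := by positivity
  refine MeasureTheory.tendsto_integral_filter_of_dominated_convergence
    (fun t : ℝ => Real.exp (C * ((1 + M) * (2 * f k x))) * Real.exp (-c * t ^ 2)) ?_ ?_ ?_ ?_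
  · filter_upwards [hylt, hfpos, hb1] with p hp1 hp2 hp3
    refine MeasureTheory.AEStronglyMeasurable.indicator ?_ measurableSet_Ioc
    exact (Complex.continuous_exp.comp (continuous_saddleExponent h k (by linarith)
      (hp1.trans hr2) hp2)).aestronglyMeasurable
  · filter_upwards [hylt, hfpos, hb1, hfle] with p hp1 hp2 hp3 hp4
    refine Filter.Eventually.of_forall fun t => ?_
    by_cases ht : t ∈ window k M (fourthRoot p.1) p.2
    · rw [Set.indicator_of_mem ht, Complex.norm_exp, ← Real.exp_add, Real.exp_le_exp]
      have hb0 : 0 < fourthRoot p.1 := by linarith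
      have habs := abs_le_of_mem_window hb0 ht
      obtain ⟨hre, hsec⟩ := hnormu p hp2 t hb0 habs
      have h1 := hC p.2 hp1.le hp2 _ t hb0 habs
      set u : ℂ := L k p.2 + t / fourthRoot p.1 * Complex.I
      have hu : 0 < u.re := by rw [hre]; exact hp2
      have h2 := re_sq_div_ge hM0 hu hsec t
      have h3 := norm_le_of_sector hu hsec
      have h4 := (Complex.re_le_norm _).trans h1
      rw [Complex.add_re] at h4
      have h5 : C * ‖u‖ / fourthRoot p.1 ^ 2 ≤ C * ((1 + M) * (2 * f k x)) := by
        refine (div_le_self (by positivity) (one_le_pow₀ hp3)).trans ?_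
        gcongr
        refine h3.trans ?_
        rw [hre]
        gcongr
      have h6 : c * t ^ 2 ≤ t ^ 2 / ((1 + M) ^ 2 * u.re) := by
        rw [hcdef, one_div_mul_eq_div, hre]
        gcongr
      linarith
    · rw [Set.indicator_of_notMem ht, norm_zero]
      positivity
  · exact (integrable_exp_neg_mul_sq hc0).const_mul _
  · refine Filter.Eventually.of_forall fun t => ?_
    have htb : Tendsto (fun p : ℕ × ℂ => t / fourthRoot p.1) l (𝓝 0) := hb.const_div_atTop t
    -- The saddle `t = 0` is interior to the window because `|Im L| < M f`, and the window grows
    -- like `b`, so it eventually contains each fixed `t`.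
    have hmem : ∀ᶠ p : ℕ × ℂ in l, t ∈ window k M (fourthRoot p.1) p.2 := by
      obtain ⟨h1, h2⟩ := abs_lt.1 hM
      have e1 : ∀ᶠ p : ℕ × ℂ in l, -(M * f k p.2) - (L k p.2).im < t / fourthRoot p.1 :=
        (((hf.const_mul M).neg.sub hLim).eventually_lt htb (by linarith))
      have e2 : ∀ᶠ p : ℕ × ℂ in l, t / fourthRoot p.1 < M * f k p.2 - (L k p.2).im :=
        (htb.eventually_lt ((hf.const_mul M).sub hLim) (by linarith))
      filter_upwards [e1, e2, hb1] with p h1 h2 h3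
      have hb0 : 0 < fourthRoot p.1 := by linarith
      rw [lt_div_iff₀ hb0] at h1
      rw [div_lt_iff₀ hb0] at h2
      exact ⟨by linarith, by linarith⟩
    have hu : Tendsto (fun p : ℕ × ℂ => L k p.2 + t / fourthRoot p.1 * Complex.I) l
        (𝓝 (L k x)) := by
      have h1 := (Complex.continuous_ofReal.tendsto _).comp htb
      have h2 := hL.add (h1.mul_const Complex.I)
      simp only [Complex.ofReal_zero, zero_mul, add_zero] at h2
      refine h2.congr fun p => ?_
      simp
    have hL0 : L k x ≠ 0 := by
      intro h0
      simp [f, h0] at hpos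
    have hq : Tendsto (fun p : ℕ × ℂ => -((t : ℂ) ^ 2 / (L k p.2 + t / fourthRoot p.1 * Complex.I)))
        l (𝓝 (-((t : ℂ) ^ 2 / L k x))) := (tendsto_const_nhds.div hu hL0).neg
    have herr : Tendsto (fun p : ℕ × ℂ => C * ‖L k p.2 + t / fourthRoot p.1 * Complex.I‖ /
        fourthRoot p.1 ^ 2) l (𝓝 0) :=
      (hu.norm.const_mul C).div_atTop ((tendsto_pow_atTop two_ne_zero).comp hb)
    have hdiff : Tendsto (fun p : ℕ × ℂ => saddleExponent h k (fourthRoot p.1) p.2 t +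
        (t : ℂ) ^ 2 / (L k p.2 + t / fourthRoot p.1 * Complex.I)) l (𝓝 0) := by
      refine squeeze_zero_norm' ?_ herr
      filter_upwards [hylt, hfpos, hb1, hmem] with p hp1 hp2 hp3 hp4
      exact hC p.2 hp1.le hp2 _ t (by linarith) (abs_le_of_mem_window (by linarith) hp4)
    have hexp := hdiff.add hq
    rw [zero_add] at hexp
    refine ((Complex.continuous_exp.tendsto _).comp hexp).congr' ?_
    filter_upwards [hmem] with p hp
    rw [Set.indicator_of_mem hp]
    simp

/-- The integrand on the arc centred at `e^{2πih/k}`, on the circle through the saddle point. -/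
def arcIntegrand (h k n : ℕ) (y : ℂ) (φ : ℝ) : ℂ :=
  Complex.exp (logGen y (circlePt (f k y / fourthRoot n ^ 2) (2 * Real.pi * h / k + φ))) *
    Complex.exp (n * ((f k y / fourthRoot n ^ 2 : ℝ) - (2 * Real.pi * h / k + φ : ℝ) * Complex.I))

/-- The integral over the arc centred at `e^{2πih/k}`. -/
def arcIntegral (h k n : ℕ) (y : ℂ) : ℂ :=
  ∫ φ in -(Real.pi / k)..Real.pi / k, arcIntegrand h k n y φ

lemma continuous_arcIntegrand (h k : ℕ) {n : ℕ} (hn : 1 ≤ n) {y : ℂ} (hy : ‖y‖ < 1)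
    (hf : 0 < f k y) : Continuous (arcIntegrand h k n y) := by
  unfold arcIntegrand
  have hb : 0 < fourthRoot n := by linarith [one_le_fourthRoot hn]
  have h1 := (continuous_logGen_circlePt hy (σ := f k y / fourthRoot n ^ 2) (by positivity)).comp
    (f := fun φ : ℝ => 2 * Real.pi * h / k + φ) (by fun_prop)
  simp only [Function.comp_def] at h1
  fun_prop

lemma sum_arcIntegral {k n : ℕ} (hk : 0 < k) (hn : 1 ≤ n) {y : ℂ} (hy : ‖y‖ < 1) (hf : 0 < f k y) :
    ∑ h ∈ Finset.range k, arcIntegral h k n y = 2 * Real.pi * (F n).eval y := by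
  have hb : 0 < fourthRoot n := by linarith [one_le_fourthRoot hn]
  have hσ : 0 < f k y / fourthRoot n ^ 2 := by positivity
  have hkr : (k : ℝ) ≠ 0 := by exact_mod_cast hk.ne'
  rw [← integral_exp_logGen hy hσ (-(Real.pi / k)) hn]
  set G : ℝ → ℂ := fun θ => Complex.exp (logGen y (circlePt (f k y / fourthRoot n ^ 2) θ)) *
    Complex.exp (n * ((f k y / fourthRoot n ^ 2 : ℝ) - θ * Complex.I)) with hG
  have hGc : Continuous G := by
    have := continuous_logGen_circlePt hy hσ
    fun_prop
  have h1 := intervalIntegral.sum_integral_adjacent_intervals (μ := MeasureTheory.volume) (f := G)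
    (a := fun i : ℕ => 2 * Real.pi * i / k - Real.pi / k) (n := k)
    (fun i _ => hGc.intervalIntegrable _ _)
  have e1 : 2 * Real.pi * ((0 : ℕ) : ℝ) / k - Real.pi / k = -(Real.pi / k) := by simp
  have e2 : 2 * Real.pi * (k : ℝ) / k - Real.pi / k = -(Real.pi / k) + 2 * Real.pi := by
    field_simp; ring
  rw [e1, e2] at h1
  rw [← h1]
  refine Finset.sum_congr rfl fun h _ => ?_
  have h2 := intervalIntegral.integral_comp_add_left (a := -(Real.pi / k)) (b := Real.pi / k) G
    (2 * Real.pi * h / k)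
  have e3 : 2 * Real.pi * h / k + -(Real.pi / k) = 2 * Real.pi * h / k - Real.pi / k := by ring
  have e4 : 2 * Real.pi * h / k + Real.pi / k = 2 * Real.pi * ((h + 1 : ℕ) : ℝ) / k - Real.pi / k := by
    push_cast; field_simp; ring
  rw [e3, e4] at h2
  rw [← h2]
  rfl

/-- The growth factor `n^{-3/4} e^{2 √n L_k(y)}`. -/
def growth (k n : ℕ) (y : ℂ) : ℂ :=
  ((fourthRoot n ^ 3)⁻¹ : ℝ) * Complex.exp (2 * fourthRoot n ^ 2 * L k y)

lemma mainTerm_eq (k n : ℕ) (y : ℂ) :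
    mainTerm k n y = 1 / (2 * (Real.sqrt Real.pi : ℂ)) * csqrt (L k y) * growth k n y := by
  rw [mainTerm, growth, rpow_neg_three_quarters, ← fourthRoot_sq]
  push_cast
  ring

lemma norm_growth (k : ℕ) (n : ℕ) (y : ℂ) :
    ‖growth k n y‖ = (fourthRoot n ^ 3)⁻¹ * Real.exp (2 * fourthRoot n ^ 2 * f k y) := by
  have hb := fourthRoot_nonneg n
  rw [growth, norm_mul, Complex.norm_real, Real.norm_of_nonneg (by positivity), Complex.norm_exp]
  congr 2
  rw [f, ← Complex.re_ofReal_mul]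
  push_cast
  rfl

lemma arcIntegrand_eq {h k n : ℕ} (hn : 1 ≤ n) (y : ℂ) (t : ℝ) :
    arcIntegrand h k n y (-1 / fourthRoot n ^ 3 * t + -(L k y).im / fourthRoot n ^ 2) =
      Complex.exp (-2 * Real.pi * Complex.I * n * h / k) * Complex.exp (w h k y) *
        Complex.exp (2 * fourthRoot n ^ 2 * L k y) *
        Complex.exp (saddleExponent h k (fourthRoot n) y t) := by
  have hb : 0 < fourthRoot n := by linarith [one_le_fourthRoot hn]
  have hbc : (fourthRoot n : ℂ) ≠ 0 := by exact_mod_cast hb.ne'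
  have hn4 : (n : ℂ) = (fourthRoot n : ℂ) ^ 4 := by
    rw [← Complex.ofReal_pow, fourthRoot_pow]; simp
  rw [arcIntegrand, saddleExponent, ← Complex.exp_add, ← Complex.exp_add, ← Complex.exp_add,
    ← Complex.exp_add]
  congr 1
  have hL : L k y = (f k y : ℂ) + (L k y).im * Complex.I := by
    rw [f, Complex.re_add_im]
  have e : (n : ℂ) * ((f k y / fourthRoot n ^ 2 : ℝ) - ((2 * Real.pi * h / k +
      (-1 / fourthRoot n ^ 3 * t + -(L k y).im / fourthRoot n ^ 2) : ℝ) : ℂ) * Complex.I) =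
      -2 * Real.pi * Complex.I * n * h / k +
        fourthRoot n ^ 2 * (L k y + t / fourthRoot n * Complex.I) := by
    have e' : (n : ℂ) * ((f k y / fourthRoot n ^ 2 : ℝ) - ((2 * Real.pi * h / k +
      (-1 / fourthRoot n ^ 3 * t + -(L k y).im / fourthRoot n ^ 2) : ℝ) : ℂ) * Complex.I) =
      -2 * Real.pi * Complex.I * n * h / k + n * ((f k y : ℂ) / fourthRoot n ^ 2 +
        (t / fourthRoot n ^ 3 + (L k y).im / fourthRoot n ^ 2) * Complex.I) := by
      push_cast
      ring
    rw [e']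
    congr 1
    nth_rewrite 2 [hL]
    rw [hn4]
    field_simp
    ring
  rw [e]
  ring

/-- The substitution `φ = -t/b³ - Im L/b²` reverses orientation, hence the swapped endpoints; its
Jacobian `b⁻³` is the factor `n^{-3/4}`. -/
lemma integral_arcIntegrand_window {h k n : ℕ} (hn : 1 ≤ n) {y : ℂ} (hf : 0 < f k y) {M : ℝ}
    (hM : 0 ≤ M) :
    ∫ φ in -(M * (f k y / fourthRoot n ^ 2))..M * (f k y / fourthRoot n ^ 2),
        arcIntegrand h k n y φ =
      Complex.exp (-2 * Real.pi * Complex.I * n * h / k) * Complex.exp (w h k y) * growth k n y *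
        ∫ t : ℝ, (window k M (fourthRoot n) y).indicator
          (fun t => Complex.exp (saddleExponent h k (fourthRoot n) y t)) t := by
  have hb : 0 < fourthRoot n := by linarith [one_le_fourthRoot hn]
  set b := fourthRoot n with hbdef
  have hle : b * (-(M * f k y) - (L k y).im) ≤ b * (M * f k y - (L k y).im) := by
    gcongr
    nlinarith [mul_nonneg hM hf.le]
  rw [window, MeasureTheory.integral_indicator measurableSet_Ioc,
    ← intervalIntegral.integral_of_le hle, growth]
  have hc : (-1 / b ^ 3 : ℝ) ≠ 0 := by
    have : b ^ 3 ≠ 0 := by positivity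
    exact div_ne_zero (by norm_num) this
  have h1 := intervalIntegral.integral_comp_mul_add (a := b * (-(M * f k y) - (L k y).im))
    (b := b * (M * f k y - (L k y).im)) (arcIntegrand h k n y) hc (-(L k y).im / b ^ 2)
  have e1 : -1 / b ^ 3 * (b * (-(M * f k y) - (L k y).im)) + -(L k y).im / b ^ 2 =
      M * (f k y / b ^ 2) := by field_simp; ring
  have e2 : -1 / b ^ 3 * (b * (M * f k y - (L k y).im)) + -(L k y).im / b ^ 2 =
      -(M * (f k y / b ^ 2)) := by field_simp; ring
  rw [e1, e2, intervalIntegral.integral_symm (-(M * (f k y / b ^ 2)))] at h1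
  simp_rw [hbdef, arcIntegrand_eq hn, ← hbdef] at h1
  rw [intervalIntegral.integral_const_mul] at h1
  have h2 : ∫ φ in -(M * (f k y / b ^ 2))..M * (f k y / b ^ 2), arcIntegrand h k n y φ =
      (b ^ 3)⁻¹ • ((-1 / b ^ 3)⁻¹ • -∫ φ in -(M * (f k y / b ^ 2))..M * (f k y / b ^ 2),
        arcIntegrand h k n y φ) := by
    rw [smul_smul]
    have : (b ^ 3)⁻¹ * (-1 / b ^ 3)⁻¹ = -1 := by field_simp
    rw [this]; simp
  rw [h2, ← h1, Complex.real_smul]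
  ring

/-! ### Assembly -/

lemma norm_arcIntegrand (h k n : ℕ) (y : ℂ) (φ : ℝ) :
    ‖arcIntegrand h k n y φ‖ = Real.exp
      ((logGen y (circlePt (f k y / fourthRoot n ^ 2) (2 * Real.pi * h / k + φ))).re +
        fourthRoot n ^ 2 * f k y) := by
  rw [arcIntegrand, norm_mul, Complex.norm_exp, Complex.norm_exp, ← Real.exp_add]
  congr 2
  have : ((n : ℂ) * ((f k y / fourthRoot n ^ 2 : ℝ) -
      (2 * Real.pi * h / k + φ : ℝ) * Complex.I)).re = n * (f k y / fourthRoot n ^ 2) := by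
    simp only [Complex.mul_re, Complex.sub_re, Complex.sub_im, Complex.natCast_re,
      Complex.natCast_im, Complex.ofReal_re, Complex.ofReal_im, Complex.I_re, Complex.I_im]
    ring
  rw [this, ← fourthRoot_pow n]
  rcases eq_or_ne (fourthRoot n) 0 with h0 | h0
  · simp [h0]
  · field_simp

lemma tendsto_pow_three_mul_exp_neg {δ : ℝ} (hδ : 0 < δ) :
    Tendsto (fun b : ℝ => b ^ 3 * Real.exp (-(δ * b ^ 2))) atTop (𝓝 0) := by
  have h1 := (Real.tendsto_pow_mul_exp_neg_atTop_nhds_zero 2).comp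
    ((tendsto_pow_atTop (α := ℝ) two_ne_zero).const_mul_atTop hδ)
  have h2 := h1.mul_const (1 / δ ^ 2)
  rw [zero_mul] at h2
  refine squeeze_zero' ?_ ?_ h2
  · filter_upwards [eventually_ge_atTop 0] with b hb
    positivity
  · filter_upwards [eventually_ge_atTop 1] with b hb
    have : (δ * b ^ 2) ^ 2 * Real.exp (-(δ * b ^ 2)) * (1 / δ ^ 2) =
        b ^ 4 * Real.exp (-(δ * b ^ 2)) := by
      field_simp
    simp only [Function.comp_apply]
    rw [this]
    gcongr
    norm_num

/-- When `h` is not coprime to `k`, no point of the arc has order `k`, so the whole arc is minor.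
Otherwise the window `|φ| ≤ Mσ` yields the main term and the two remaining pieces are minor. -/
theorem tendsto_arcIntegral {x : ℂ} (hx : ‖x‖ < 1) {k : ℕ} (hk : 0 < k)
    (hmax : ∀ j, 0 < j → j ≠ k → f j x < f k x) (hpos : 0 < f k x) (h : ℕ) :
    Tendsto (fun p : ℕ × ℂ => arcIntegral h k p.1 p.2 / growth k p.1 p.2 -
      if h.Coprime k then Complex.exp (-2 * Real.pi * Complex.I * p.1 * h / k) *
        Complex.exp (w h k p.2) * ((Real.sqrt Real.pi : ℂ) * csqrt (L k p.2)) else 0)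
      (atTop ×ˢ 𝓝 x) (𝓝 0) := by
  -- Large enough both for the minor-arc condition `|L|²/M < f²` and for the saddle to lie inside
  -- the window.
  set M : ℝ := 2 * ‖L k x‖ ^ 2 / f k x ^ 2 + 1 with hMdef
  have hM : 0 < M := by positivity
  have hML : ‖L k x‖ ^ 2 / M < f k x ^ 2 := by
    rw [div_lt_iff₀ hM, hMdef, mul_add, mul_div_cancel₀ _ (by positivity)]
    nlinarith [sq_nonneg ‖L k x‖, pow_pos hpos 2]
  have hMim : |(L k x).im| < M * f k x := by
    have h1 := Complex.abs_im_le_norm (L k x)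
    have h2 : f k x ≤ ‖L k x‖ := Complex.re_le_norm _
    have h3 : M * f k x = 2 * ‖L k x‖ ^ 2 / f k x + f k x := by
      rw [hMdef]; field_simp
    have h4 : ‖L k x‖ ≤ 2 * ‖L k x‖ ^ 2 / f k x := by
      rw [le_div_iff₀ hpos]
      nlinarith [norm_nonneg (L k x)]
    linarith
  obtain ⟨c, hc, hminor⟩ := exists_minor_arc_bound hx hk hmax hpos h hM hML
  set l : Filter (ℕ × ℂ) := atTop ×ˢ 𝓝 x
  have hb : Tendsto (fun p : ℕ × ℂ => fourthRoot p.1) l atTop := tendsto_fourthRoot.comp tendsto_fst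
  have hb2 : Tendsto (fun p : ℕ × ℂ => fourthRoot p.1 ^ 2) l atTop :=
    (tendsto_pow_atTop two_ne_zero).comp hb
  have hy : Tendsto (fun p : ℕ × ℂ => p.2) l (𝓝 x) := tendsto_snd
  have hf : Tendsto (fun p : ℕ × ℂ => f k p.2) l (𝓝 (f k x)) := (tendsto_f hk hx hpos).comp hy
  have hn1 : ∀ᶠ p : ℕ × ℂ in l, 1 ≤ p.1 := tendsto_fst.eventually (eventually_ge_atTop 1)
  have hfpos : ∀ᶠ p : ℕ × ℂ in l, 0 < f k p.2 := hf.eventually_const_lt hpos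
  have hylt : ∀ᶠ p : ℕ × ℂ in l, ‖p.2‖ < 1 := hy.norm.eventually_lt_const hx
  have hσ0 : Tendsto (fun p : ℕ × ℂ => f k p.2 / fourthRoot p.1 ^ 2) l (𝓝 0) := hf.div_atTop hb2
  have hσ : Tendsto (fun p : ℕ × ℂ => (f k p.2 / fourthRoot p.1 ^ 2, p.2)) l
      (𝓝[>] 0 ×ˢ 𝓝 x) := by
    refine Tendsto.prodMk (tendsto_nhdsWithin_iff.2 ⟨hσ0, ?_⟩) hy
    filter_upwards [hfpos, hn1] with p hp hp1
    have : 0 < fourthRoot p.1 := by linarith [one_le_fourthRoot hp1]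
    exact Set.mem_Ioi.2 (by positivity)
  -- Off the window the integrand is at most `e^{b²(c/f + f)}`, against `e^{2b²f}` at the saddle;
  -- `δ` is half the gap in the exponents at `x`, leaving room for `y` near `x`.
  set δ : ℝ := (f k x - c / f k x) / 2 with hδdef
  have hδ : 0 < δ := by
    have : c / f k x < f k x := by rw [div_lt_iff₀ hpos]; nlinarith
    rw [hδdef]; linarith
  have hgap : ∀ᶠ p : ℕ × ℂ in l, c / f k p.2 + f k p.2 < 2 * f k p.2 - δ := by
    refine Tendsto.eventually_lt ((tendsto_const_nhds.div hf hpos.ne').add hf)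
      ((hf.const_mul 2).sub_const δ) ?_
    rw [hδdef] at hδ ⊢
    linarith
  have hout : ∀ᶠ p : ℕ × ℂ in l, ∀ φ ∈ Set.Icc (-(Real.pi / k)) (Real.pi / k),
      (h.Coprime k → M * (f k p.2 / fourthRoot p.1 ^ 2) ≤ |φ|) →
      ‖arcIntegrand h k p.1 p.2 φ‖ ≤
        Real.exp (fourthRoot p.1 ^ 2 * (2 * f k p.2 - δ)) := by
    filter_upwards [hσ.eventually hminor, hgap, hfpos, hn1] with p h1 h2 h3 h4 φ hφ hcop
    have hb0 : 0 < fourthRoot p.1 := by linarith [one_le_fourthRoot h4]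
    have h5 := h1 φ hφ hcop
    rw [norm_arcIntegrand, Real.exp_le_exp]
    set R := (logGen p.2 (circlePt (f k p.2 / fourthRoot p.1 ^ 2)
      (2 * Real.pi * h / k + φ))).re
    have h6 : R ≤ fourthRoot p.1 ^ 2 * (c / f k p.2) := by
      have : R = fourthRoot p.1 ^ 2 / f k p.2 * (f k p.2 / fourthRoot p.1 ^ 2 * R) := by
        field_simp
      rw [this]
      calc _ ≤ fourthRoot p.1 ^ 2 / f k p.2 * c := by gcongr
        _ = _ := by ring
    have h7 := mul_le_mul_of_nonneg_left h2.le (sq_nonneg (fourthRoot p.1))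
    linarith
  have hdecay : Tendsto (fun p : ℕ × ℂ => fourthRoot p.1 ^ 3 *
      Real.exp (-(δ * fourthRoot p.1 ^ 2)) * (2 * (Real.pi / k))) l (𝓝 0) := by
    have := ((tendsto_pow_three_mul_exp_neg hδ).comp hb).mul_const (2 * (Real.pi / k))
    simpa using this
  have hratio : ∀ p : ℕ × ℂ, 1 ≤ p.1 → ∀ A : ℂ,
      ‖A‖ ≤ Real.exp (fourthRoot p.1 ^ 2 * (2 * f k p.2 - δ)) * (2 * (Real.pi / k)) →
      ‖A / growth k p.1 p.2‖ ≤ fourthRoot p.1 ^ 3 *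
        Real.exp (-(δ * fourthRoot p.1 ^ 2)) * (2 * (Real.pi / k)) := by
    intro p hp A hA
    have hb0 : 0 < fourthRoot p.1 := by linarith [one_le_fourthRoot hp]
    rw [norm_div, norm_growth, div_le_iff₀ (by positivity)]
    refine hA.trans (le_of_eq ?_)
    have e : fourthRoot p.1 ^ 2 * (2 * f k p.2 - δ) =
        -(δ * fourthRoot p.1 ^ 2) + 2 * fourthRoot p.1 ^ 2 * f k p.2 := by ring
    rw [e, Real.exp_add]
    field_simp
  have hkr : (0 : ℝ) < k := by exact_mod_cast hk
  by_cases hcop : h.Coprime k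
  · simp only [if_pos hcop]
    obtain ⟨r, hr1, hr2⟩ := exists_between hx
    obtain ⟨C, hC⟩ := exists_norm_w_le hk hcop ((norm_nonneg x).trans hr1.le) hr2
    have hyr : ∀ᶠ p : ℕ × ℂ in l, ‖p.2‖ < r := hy.norm.eventually_lt_const hr1
    have hwin := tendsto_integral_window hk hcop hx hpos hMim
    have hL : Tendsto (fun p : ℕ × ℂ => L k p.2) l (𝓝 (L k x)) :=
      (continuousAt_L hk hx hpos).tendsto.comp hy
    have hsqrt : Tendsto (fun p : ℕ × ℂ => (Real.sqrt Real.pi : ℂ) * csqrt (L k p.2)) l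
        (𝓝 ((Real.sqrt Real.pi : ℂ) * csqrt (L k x))) :=
      ((continuousAt_csqrt (Complex.mem_slitPlane_iff.2 (Or.inl hpos))).tendsto.comp hL).const_mul _
    have hmain := (hwin.sub hsqrt).norm.const_mul (Real.exp C)
    rw [sub_self, norm_zero, mul_zero] at hmain
    have htot := hdecay.add hmain
    rw [zero_add] at htot
    have hsmall : ∀ᶠ p : ℕ × ℂ in l, M * (f k p.2 / fourthRoot p.1 ^ 2) < Real.pi / k := by
      have := hσ0.const_mul M
      rw [mul_zero] at this
      exact this.eventually_lt_const (by positivity)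
    refine squeeze_zero_norm' ?_ htot
    filter_upwards [hout, hfpos, hn1, hylt, hsmall, hyr] with p ho hp1 hp2 hp3 hp4 hp5
    have hb0 : 0 < fourthRoot p.1 := by linarith [one_le_fourthRoot hp2]
    have hcont := continuous_arcIntegrand h k hp2 hp3 hp1
    have hwint := integral_arcIntegrand_window (h := h) hp2 hp1 hM.le
    set η := M * (f k p.2 / fourthRoot p.1 ^ 2) with hη
    have hη0 : 0 < η := by positivity
    set a := Real.pi / k with ha
    set B := Real.exp (fourthRoot p.1 ^ 2 * (2 * f k p.2 - δ)) with hB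
    have hB0 : 0 < B := Real.exp_pos _
    have hsplit : arcIntegral h k p.1 p.2 =
        ((∫ φ in -a..-η, arcIntegrand h k p.1 p.2 φ) + ∫ φ in η..a, arcIntegrand h k p.1 p.2 φ) +
          ∫ φ in -η..η, arcIntegrand h k p.1 p.2 φ := by
      rw [arcIntegral, ← intervalIntegral.integral_add_adjacent_intervals
        (hcont.intervalIntegrable (-a) (-η)) (hcont.intervalIntegrable (-η) a),
        ← intervalIntegral.integral_add_adjacent_intervals
        (hcont.intervalIntegrable (-η) η) (hcont.intervalIntegrable η a)]
      ring
    have hI1 : ‖∫ φ in -a..-η, arcIntegrand h k p.1 p.2 φ‖ ≤ B * a := by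
      refine (intervalIntegral.norm_integral_le_of_norm_le_const (C := B) fun φ hφ => ?_).trans ?_
      · rw [Set.uIoc_of_le (by linarith)] at hφ
        refine ho φ ⟨hφ.1.le, by linarith [hφ.2]⟩ fun _ => ?_
        rw [abs_of_nonpos (by linarith [hφ.2])]
        linarith [hφ.2]
      · gcongr
        rw [abs_of_nonneg (by linarith)]
        linarith
    have hI3 : ‖∫ φ in η..a, arcIntegrand h k p.1 p.2 φ‖ ≤ B * a := by
      refine (intervalIntegral.norm_integral_le_of_norm_le_const (C := B) fun φ hφ => ?_).trans ?_
      · rw [Set.uIoc_of_le (by linarith)] at hφ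
        refine ho φ ⟨by linarith [hφ.1], hφ.2⟩ fun _ => ?_
        rw [abs_of_nonneg (by linarith [hφ.1])]
        exact hφ.1.le
      · gcongr
        rw [abs_of_nonneg (by linarith)]
        linarith
    have hg0 : growth k p.1 p.2 ≠ 0 := by
      rw [← norm_pos_iff, norm_growth]
      positivity
    have hI13 := hratio p hp2 _ ((norm_add_le (∫ φ in -a..-η, arcIntegrand h k p.1 p.2 φ)
      (∫ φ in η..a, arcIntegrand h k p.1 p.2 φ)).trans
      (show _ ≤ B * (2 * a) by linarith))
    set I13 := (∫ φ in -a..-η, arcIntegrand h k p.1 p.2 φ) + ∫ φ in η..a, arcIntegrand h k p.1 p.2 φ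
    rw [hsplit, hwint]
    set E := Complex.exp (-2 * Real.pi * Complex.I * p.1 * h / k) with hE
    set W := ∫ t : ℝ, (window k M (fourthRoot p.1) p.2).indicator
      (fun t => Complex.exp (saddleExponent h k (fourthRoot p.1) p.2 t)) t
    have e : (I13 + E * Complex.exp (w h k p.2) * growth k p.1 p.2 * W) / growth k p.1 p.2 -
        E * Complex.exp (w h k p.2) * ((Real.sqrt Real.pi : ℂ) * csqrt (L k p.2)) =
        I13 / growth k p.1 p.2 + E * Complex.exp (w h k p.2) *
          (W - (Real.sqrt Real.pi : ℂ) * csqrt (L k p.2)) := by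
      field_simp
      ring
    rw [e]
    refine (norm_add_le _ _).trans (add_le_add hI13 ?_)
    have hE1 : ‖E‖ = 1 :=
      Complex.norm_eq_one_of_pow_eq_one (exp_neg_pow_eq_one (h := h) hk p.1) hk.ne'
    rw [norm_mul, norm_mul, hE1, one_mul, Complex.norm_exp]
    gcongr
    exact (Complex.re_le_norm _).trans (hC _ hp5.le)
  · simp only [if_neg hcop, sub_zero]
    refine squeeze_zero_norm' ?_ hdecay
    filter_upwards [hout, hn1] with p ho hp2
    refine hratio p hp2 _ ?_
    rw [arcIntegral]
    refine (intervalIntegral.norm_integral_le_of_norm_le_const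
      (C := Real.exp (fourthRoot p.1 ^ 2 * (2 * f k p.2 - δ))) fun φ hφ => ?_).trans_eq ?_
    · rw [Set.uIoc_of_le (by linarith [show 0 < Real.pi / k by positivity])] at hφ
      exact ho φ ⟨hφ.1.le, hφ.2⟩ fun h' => absurd h' hcop
    · rw [abs_of_nonneg (by linarith [show 0 < Real.pi / k by positivity])]
      ring

/-- The sum of the contributions of the primitive `k`-th roots of unity, relative to `mainTerm`. -/
def coeffSum (k n : ℕ) (y : ℂ) : ℂ :=
  ∑ h ∈ Finset.range k, if h.Coprime k then
    Complex.exp (-2 * Real.pi * Complex.I * n * h / k) * Complex.exp (w h k y) else 0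

theorem eventually_norm_eval_F_sub_le {x : ℂ} (hx : ‖x‖ < 1) {k : ℕ} (hk : 0 < k)
    (hmax : ∀ j, 0 < j → j ≠ k → f j x < f k x) (hpos : 0 < f k x) {ε : ℝ} (hε : 0 < ε) :
    ∀ᶠ p : ℕ × ℂ in atTop ×ˢ 𝓝 x,
      ‖(F p.1).eval p.2 - coeffSum k p.1 p.2 * mainTerm k p.1 p.2‖ ≤
        ε * ‖mainTerm k p.1 p.2‖ := by
  set l : Filter (ℕ × ℂ) := atTop ×ˢ 𝓝 x
  have hsum := tendsto_finsetSum (Finset.range k) fun h _ =>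
    tendsto_arcIntegral hx hk hmax hpos h
  rw [Finset.sum_const_zero] at hsum
  have hy : Tendsto (fun p : ℕ × ℂ => p.2) l (𝓝 x) := tendsto_snd
  have hL : Tendsto (fun p : ℕ × ℂ => L k p.2) l (𝓝 (L k x)) :=
    (continuousAt_L hk hx hpos).tendsto.comp hy
  have hsqrt : Tendsto (fun p : ℕ × ℂ => ‖csqrt (L k p.2)‖) l (𝓝 ‖csqrt (L k x)‖) :=
    ((continuousAt_csqrt (Complex.mem_slitPlane_iff.2 (Or.inl hpos))).tendsto.comp hL).norm
  have hs0 : 0 < ‖csqrt (L k x)‖ := by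
    rw [norm_pos_iff]
    intro h0
    have := csqrt_sq (L k x)
    rw [h0, zero_pow two_ne_zero] at this
    simp [f, ← this] at hpos
  have hf : Tendsto (fun p : ℕ × ℂ => f k p.2) l (𝓝 (f k x)) := (tendsto_f hk hx hpos).comp hy
  have hpi : 0 < Real.sqrt Real.pi := Real.sqrt_pos.2 Real.pi_pos
  have hn1 : ∀ᶠ p : ℕ × ℂ in l, 1 ≤ p.1 := tendsto_fst.eventually (eventually_ge_atTop 1)
  -- Since `csqrt (L k y)` stays away from zero near `x`, an error small against `growth` is small
  -- against `mainTerm`.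
  have hsmall := (hsum.norm).eventually_lt_const
    (u := ε * Real.sqrt Real.pi * (‖csqrt (L k x)‖ / 2)) (by rw [norm_zero]; positivity)
  filter_upwards [hsmall, hsqrt.eventually_const_lt (half_lt_self hs0), hn1,
    hf.eventually_const_lt hpos, hy.norm.eventually_lt_const hx] with p h1 h2 h3 h4 h5
  have hb0 : 0 < fourthRoot p.1 := by linarith [one_le_fourthRoot h3]
  have hg0 : growth k p.1 p.2 ≠ 0 := by
    rw [← norm_pos_iff, norm_growth]
    positivity
  have hF := sum_arcIntegral hk h3 h5 h4
  have hpic : (Real.pi : ℂ) ≠ 0 := by exact_mod_cast Real.pi_ne_zero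
  have hspc : (Real.sqrt Real.pi : ℂ) ≠ 0 := by exact_mod_cast hpi.ne'
  have hsq : (Real.pi : ℂ) = (Real.sqrt Real.pi : ℂ) ^ 2 := by
    rw [← Complex.ofReal_pow, Real.sq_sqrt Real.pi_pos.le]
  set D := ∑ h ∈ Finset.range k, (arcIntegral h k p.1 p.2 / growth k p.1 p.2 -
      if h.Coprime k then Complex.exp (-2 * Real.pi * Complex.I * p.1 * h / k) *
        Complex.exp (w h k p.2) * ((Real.sqrt Real.pi : ℂ) * csqrt (L k p.2)) else 0) with hD
  have hDe : D = 2 * Real.pi * (F p.1).eval p.2 / growth k p.1 p.2 -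
      coeffSum k p.1 p.2 * ((Real.sqrt Real.pi : ℂ) * csqrt (L k p.2)) := by
    rw [hD, Finset.sum_sub_distrib, ← Finset.sum_div, hF, coeffSum, Finset.sum_mul]
    congr 1
    refine Finset.sum_congr rfl fun h _ => ?_
    split_ifs
    · rfl
    · rw [zero_mul]
  have e : (F p.1).eval p.2 - coeffSum k p.1 p.2 * mainTerm k p.1 p.2 =
      growth k p.1 p.2 / (2 * Real.pi) * D := by
    rw [hDe, mainTerm_eq, hsq]
    field_simp
  rw [e, mainTerm_eq, norm_mul, norm_mul, norm_mul, norm_div]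
  have hn2 : ‖(2 * Real.pi : ℂ)‖ = 2 * Real.sqrt Real.pi ^ 2 := by
    rw [norm_mul, Complex.norm_real, Real.norm_of_nonneg Real.pi_pos.le, Real.sq_sqrt Real.pi_pos.le]
    simp
  have hn3 : ‖1 / (2 * (Real.sqrt Real.pi : ℂ))‖ = 1 / (2 * Real.sqrt Real.pi) := by
    rw [norm_div, norm_mul, Complex.norm_real, Real.norm_of_nonneg hpi.le]
    simp
  rw [hn2, hn3]
  calc ‖growth k p.1 p.2‖ / (2 * Real.sqrt Real.pi ^ 2) * ‖D‖
      ≤ ‖growth k p.1 p.2‖ / (2 * Real.sqrt Real.pi ^ 2) *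
        (ε * Real.sqrt Real.pi * ‖csqrt (L k p.2)‖) := by
        refine mul_le_mul_of_nonneg_left (h1.le.trans ?_) (by positivity)
        gcongr
    _ = _ := by field_simp

theorem asympOnCompacts_of_forall {k : ℕ} (hk : 0 < k) {S : Set ℂ} (hS1 : ∀ x ∈ S, ‖x‖ < 1)
    (hpos : ∀ x ∈ S, 0 < f k x) (hmax : ∀ x ∈ S, ∀ j, 0 < j → j ≠ k → f j x < f k x) :
    AsympOnCompacts S (fun n x => (F n).eval x) (fun n x => coeffSum k n x * mainTerm k n x)
      (mainTerm k) := by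
  intro K hK hKS ε hε
  refine hK.induction_on (p := fun s => ∃ N : ℕ, ∀ n ≥ N, ∀ x ∈ s,
    ‖(F n).eval x - coeffSum k n x * mainTerm k n x‖ ≤ ε * ‖mainTerm k n x‖) ?_ ?_ ?_ ?_
  · exact ⟨0, by simp⟩
  · rintro s t hst ⟨N, hN⟩
    exact ⟨N, fun n hn x hx => hN n hn x (hst hx)⟩
  · rintro s t ⟨N, hN⟩ ⟨N', hN'⟩
    refine ⟨max N N', fun n hn x hx => ?_⟩
    rcases hx with hx | hx
    · exact hN n ((le_max_left _ _).trans hn) x hx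
    · exact hN' n ((le_max_right _ _).trans hn) x hx
  · intro x hx
    have hxS := hKS hx
    have hev := eventually_norm_eval_F_sub_le (hS1 x hxS) hk (hmax x hxS) (hpos x hxS) hε
    obtain ⟨P, hP, Q, hQ, hPQ⟩ := eventually_prod_iff.1 hev
    obtain ⟨N, hN⟩ := eventually_atTop.1 hP
    exact ⟨{y | Q y}, mem_nhdsWithin_of_mem_nhds hQ, N, fun n hn y hy => hPQ (hN n hn) hy⟩

lemma f_lt_of_mem_region {k : ℕ} (hk : k ∈ Finset.Icc 1 3) {x : ℂ} (hx : x ∈ region k) {j : ℕ}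
    (hj : 0 < j) (hjk : j ≠ k) : f j x < f k x := by
  obtain ⟨hU, h⟩ := hx
  have hle : ∀ i ∈ Finset.Icc 1 3, f i x ≤ f k x := by
    intro i hi
    rcases eq_or_ne i k with rfl | hne
    · exact le_rfl
    · exact (h i hi hne).le
  by_cases hj3 : j ≤ 3
  · exact h j (Finset.mem_Icc.2 ⟨hj, hj3⟩) hjk
  · rcases f_lt_f_one_or_f_two hU (j := j) (by omega) with h1 | h1
    · exact h1.trans_le (hle 1 (by decide))
    · exact h1.trans_le (hle 2 (by decide))

theorem asympOnCompacts_region {k : ℕ} (hk : k ∈ Finset.Icc 1 3) :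
    AsympOnCompacts (region k) (fun n x => (F n).eval x)
      (fun n x => coeffSum k n x * mainTerm k n x) (mainTerm k) := by
  have hk0 : 0 < k := (Finset.mem_Icc.1 hk).1
  refine asympOnCompacts_of_forall hk0 (fun x hx => hx.1.1) (fun x hx => ?_)
    (fun x hx j hj hjk => f_lt_of_mem_region hk hx hj hjk)
  -- Strict dominance over `f_{k+1} ≥ 0` already forces `f_k > 0`.
  exact (f_nonneg (k + 1) x).trans_lt
    (f_lt_of_mem_region hk hx (Nat.succ_pos k) (Nat.succ_ne_self k))

lemma coeffSum_one (n : ℕ) (x : ℂ) : coeffSum 1 n x = Complex.exp (w 0 1 x) := by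
  simp [coeffSum]

lemma coeffSum_two (n : ℕ) (x : ℂ) : coeffSum 2 n x = (-1) ^ n * Complex.exp (w 1 2 x) := by
  have e : Complex.exp (-2 * Real.pi * Complex.I * n * (1 : ℕ) / (2 : ℕ)) = (-1) ^ n := by
    rw [← Complex.exp_pi_mul_I, ← Complex.exp_nat_mul, Complex.exp_eq_exp_iff_exists_int]
    exact ⟨-n, by push_cast; ring⟩
  rw [coeffSum, Finset.sum_range_succ, Finset.sum_range_one, if_neg (by decide),
    if_pos (by decide), zero_add, e]

lemma coeffSum_three (n : ℕ) (x : ℂ) : coeffSum 3 n x =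
    Complex.exp (-2 * Real.pi * Complex.I * n / 3) * Complex.exp (w 1 3 x) +
      Complex.exp (-4 * Real.pi * Complex.I * n / 3) * Complex.exp (w 2 3 x) := by
  have e1 : (-2 * Real.pi * Complex.I * n * (1 : ℕ) / (3 : ℕ) : ℂ) =
      -2 * Real.pi * Complex.I * n / 3 := by push_cast; ring
  have e2 : (-2 * Real.pi * Complex.I * n * (2 : ℕ) / (3 : ℕ) : ℂ) =
      -4 * Real.pi * Complex.I * n / 3 := by push_cast; ring
  rw [coeffSum, Finset.sum_range_succ, Finset.sum_range_succ, Finset.sum_range_one,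
    if_neg (by decide), if_pos (by decide), if_pos (by decide), zero_add, e1, e2]

end PartitionPolynomials

end

theorem mainTheorem2 :
    PartitionPolynomials.AsympOnCompacts (PartitionPolynomials.region 1)
      (fun n x => (PartitionPolynomials.F n).eval x)
      (fun n x => Complex.exp (PartitionPolynomials.w 0 1 x) *
        PartitionPolynomials.mainTerm 1 n x)
      (PartitionPolynomials.mainTerm 1) ∧
    PartitionPolynomials.AsympOnCompacts (PartitionPolynomials.region 2)
      (fun n x => (PartitionPolynomials.F n).eval x)
      (fun n x => (-1) ^ n * Complex.exp (PartitionPolynomials.w 1 2 x) *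
        PartitionPolynomials.mainTerm 2 n x)
      (PartitionPolynomials.mainTerm 2) ∧
    PartitionPolynomials.AsympOnCompacts (PartitionPolynomials.region 3)
      (fun n x => (PartitionPolynomials.F n).eval x)
      (fun n x =>
        (Complex.exp (-2 * Real.pi * Complex.I * n / 3) *
            Complex.exp (PartitionPolynomials.w 1 3 x) +
          Complex.exp (-4 * Real.pi * Complex.I * n / 3) *
            Complex.exp (PartitionPolynomials.w 2 3 x)) *
        PartitionPolynomials.mainTerm 3 n x)
      (PartitionPolynomials.mainTerm 3) := by
  have h1 := PartitionPolynomials.asympOnCompacts_region (k := 1) (by decide)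
  have h2 := PartitionPolynomials.asympOnCompacts_region (k := 2) (by decide)
  have h3 := PartitionPolynomials.asympOnCompacts_region (k := 3) (by decide)
  simp only [PartitionPolynomials.coeffSum_one] at h1
  simp only [PartitionPolynomials.coeffSum_two] at h2
  simp only [PartitionPolynomials.coeffSum_three] at h3
  exact ⟨h1, h2, h3⟩
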